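/- Setting. Let $M$ be a smooth (Hausdorff, second countable) manifold and let $E\to M$ be a Courant algebroid: a smooth vector bundle of finite rank with a smooth fibrewise nondegenerate symmetric bilinear form $\langle\cdot,\cdot\rangle$, a smooth bundle map $\rho:E\to TM$ and an $\mathbb R$-bilinear bracket $[\cdot,\cdot]$ on $\Gamma(E)$ with $[e_1,[e_2,e_3]]=[[e_1,e_2],e_3]+[e_2,[e_1,e_3]]$, $\rho(e_1)\langle e_2,e_3\rangle=\langle[e_1,e_2],e_3\rangle+\langle e_2,[e_1,e_3]\rangle$ and $[e_1,e_2]+[e_2,e_1]=d_E\langle e_1,e_2\rangle$. Here $\rho^*:\Omega^1(M)\to\Gamma(E)$ is given by $\langle\rho^*\alpha,e\rangle=\alpha(\rho(e))$, and $d_Ef=\rho^*(df)$. Let $B\to M$ be a predual of $E$: a smooth vector bundle of finite rank with a smooth fibrewise bilinear pairing $\langle\!\langle\cdot,\cdot\rangle\!\rangle:E\times_M B\to\mathbb R$ and a map $d_B:C^\infty(M)\to\Gamma(B)$ with $\langle\!\langle e,d_Bf\rangle\!\rangle=\rho(e)(f)$. Let $\nabla$ be an $E$-Dorfman connection on $B$: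 an $\mathbb R$-bilinear map $\Gamma(E)\times\Gamma(B)\to\Gamma(B)$ with $\nabla_{fe}b=f\nabla_eb+\langle\!\langle e,b\rangle\!\rangle\,d_Bf$, $\nabla_e(fb)=f\nabla_eb+\rho(e)(f)\,b$ and $\nabla_e(d_Bf)=d_B(\rho(e)(f))$. Cochains. Let $W$ be $C^\infty(M)$ or $\Gamma(B)$, $p\in\mathbb Z$, $m\ge1$. $\mathfrak D^p_{m,m-1}(E;W)$ consists of the tuples $H=(H_0,\dots,H_{[p/2]})$ of $\mathbb R$-multilinear maps $H_k:\Gamma(E)^{p-2k}\times\Omega^1(M)^k\to W$, symmetric in the one-forms, with $$H_k(\dots,e_i,e_{i+1},\dots;\alpha_1,\dots,\alpha_k)+H_k(\dots,e_{i+1},e_i,\dots;\alpha_1,\dots,\alpha_k)=-H_{k+1}(\dots,\hat e_i,\hat e_{i+1},\dots;d\langle e_i,e_{i+1}\rangle,\alpha_1,\dots,\alpha_k),$$ which are differential operators of order at most $m$ in each one-form and in each of the first $p-2k-1$ sections, and of order at most $m-1$ in the $(p-2k)$-th section; if $p=1$ the order in the only section is at most $m$. It is $W$ for $p=0$ and $0$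 for $p<0$. Write $\mathfrak D^p_{m,m-1}=\mathfrak D^p_{m,m-1}(E;C^\infty(M))$, and identify $\mathfrak D^p_{m,m-1}\otimes\Gamma(B)$ with $\mathfrak D^p_{m,m-1}(E;\Gamma(B))$, where $(\omega\otimes b)_k=\omega_k(\cdot)\,b$. The product $\omega\cdot H$ of a scalar cochain with a $W$-valued one is $$(\omega\cdot H)_k(e_1,\dots;\alpha_1,\dots,\alpha_k)=\sum_{r+s=k}\ \sum_{\sigma,\tau}\operatorname{sgn}(\sigma)\,\omega_r(e_{\sigma(1)},\dots;\alpha_{\tau(1)},\dots,\alpha_{\tau(r)})\,H_s(\dots,e_{\sigma(\cdot)};\alpha_{\tau(r+1)},\dots,\alpha_{\tau(k)}),$$ over all shuffles $\sigma$ of the sections and $\tau$ of the one-forms. Operators. $(i_eH)_k(\cdots)=H_k(e,\cdots)$ and $(i_fH)_k(\cdots;\alpha_1,\dots,\alpha_k)=H_{k+1}(\cdots;df,\alpha_1,\dots,\alpha_k)$ for $e\in\Gamma(E)$, $f\in C^\infty(M)$. Put $$(d^\nabla H)_k(e_1,\dots,e_q;\alpha_1,\dots,\alpha_k)=\sum_{\mu}H_{k-1}(\rho^*\alpha_\mu,e_1,\dots,e_q;\dots,\hat\alpha_\mu,\dots)$$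 $$+\sum_{i}(-1)^{i-1}\Big(\nabla_{e_i}\big(H_k(\dots,\hat e_i,\dots;\alpha_1,\dots,\alpha_k)\big)-\sum_\mu H_k(\dots,\hat e_i,\dots;\alpha_1,\dots,i_{\rho(e_i)}d\alpha_\mu,\dots,\alpha_k)\Big)$$ $$+\sum_{i<l}(-1)^iH_k(\dots,\hat e_i,\dots,e_{l-1},[e_i,e_l],e_{l+1},\dots;\alpha_1,\dots,\alpha_k),$$ with $q=p+1-2k$; $d$ on scalar cochains is given by the same formula with $\rho(e_i)$ acting on functions in place of $\nabla_{e_i}$. With graded commutators, put $$\mathcal L_e=\{i_e,d\}=i_ed+d\,i_e,\qquad \nabla_e=\{i_e,d^\nabla\}=i_ed^\nabla+d^\nabla i_e,\qquad \mathcal L^\nabla_f=\{i_f,d^\nabla\}=i_fd^\nabla-d^\nabla i_f .$$ Proposition. For all $p\in\mathbb Z$ and $m\ge1$: (a) For $b\in\Gamma(B)$, $d^\nabla b\in\mathfrak D^1_1(E;\Gamma(B))$ is the map $e\mapsto\nabla_eb$, and for $\omega\in\mathfrak D^p_{m,m-1}$ one has $\omega\otimes b\in\mathfrak D^p_{m,m-1}(E;\Gamma(B))$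 and $d^\nabla(\omega\otimes b)=d\omega\otimes b+(-1)^p\,\omega\cdot d^\nabla b$. (b) $d^\nabla$ maps $\mathfrak D^p_{m,m-1}(E;\Gamma(B))$ to $\mathfrak D^{p+1}_{m+1,m}(E;\Gamma(B))$. Hence there are operators $\nabla_e$, mapping $\mathfrak D^p_{m,m-1}(E;\Gamma(B))$ to $\mathfrak D^{p}_{m+1,m}(E;\Gamma(B))$, and $\mathcal L^\nabla_f$, mapping it to $\mathfrak D^{p-1}_{m+1,m}(E;\Gamma(B))$; in degree $0$ the operator $\nabla_e$ is the given connection. (c) For all $\omega\in\mathfrak D^p_{m,m-1}$, $b\in\Gamma(B)$, $e\in\Gamma(E)$ and $f\in C^\infty(M)$, $$\nabla_e(\omega\otimes b)=(\mathcal L_e\omega)\otimes b+\omega\cdot\nabla_eb\qquad\text{and}\qquad\mathcal L^\nabla_f(\omega\otimes b)=(i_{d_Ef}\,\omega)\otimes b .$$ -/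

import Mathlib

open scoped Manifold ContDiff Bundle
open Bundle

noncomputable section

/-! ### Smooth functions, sections, vector fields and one-forms on a smooth manifold -/

section Geometry

/-- The algebra `C^∞(M)` of smooth real functions. -/
abbrev SmoothFun (n : ℕ) (M : Type*) [TopologicalSpace M]
    [ChartedSpace (EuclideanSpace ℝ (Fin n)) M] :=
  C^∞⟮𝓡 n, M; 𝓘(ℝ, ℝ), ℝ⟯

/-- The space `Γ(E)` of smooth sections of a vector bundle `E` with model fibre `F`. -/
abbrev Sec (n : ℕ) {M : Type*} [TopologicalSpace M] [ChartedSpace (EuclideanSpace ℝ (Fin n)) M]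
    (F : Type*) [NormedAddCommGroup F] [NormedSpace ℝ F]
    (E : M → Type*) [TopologicalSpace (TotalSpace F E)] [∀ x, TopologicalSpace (E x)]
    [FiberBundle F E] :=
  Cₛ^∞⟮𝓡 n; F, E⟯

/-- The space of smooth vector fields. -/
abbrev VecField (n : ℕ) (M : Type*) [TopologicalSpace M]
    [ChartedSpace (EuclideanSpace ℝ (Fin n)) M] [IsManifold (𝓡 n) ∞ M] :=
  Sec n (EuclideanSpace ℝ (Fin n)) (TangentSpace (𝓡 n) : M → Type _)

/-- The space `Ω¹` of smooth one-forms, i.e. smooth sections of the cotangent bundle. -/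
abbrev OneForm (n : ℕ) (M : Type*) [TopologicalSpace M]
    [ChartedSpace (EuclideanSpace ℝ (Fin n)) M] [IsManifold (𝓡 n) ∞ M] :=
  Sec n (EuclideanSpace ℝ (Fin n) →L[ℝ] ℝ) (fun x : M => TangentSpace (𝓡 n) x →L[ℝ] ℝ)

variable {n : ℕ} {M : Type*} [TopologicalSpace M] [ChartedSpace (EuclideanSpace ℝ (Fin n)) M]

section Bundle

variable {F : Type*} [NormedAddCommGroup F] [NormedSpace ℝ F]
  {E : M → Type*} [∀ x, AddCommGroup (E x)] [∀ x, Module ℝ (E x)] [∀ x, TopologicalSpace (E x)]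
  [TopologicalSpace (TotalSpace F E)] [FiberBundle F E] [VectorBundle ℝ F E]

/-- Pointwise multiplication of a smooth section by a smooth function. -/
instance Sec.instSMulSmoothFun : SMul (SmoothFun n M) (Sec n F E) :=
  ⟨fun f s => ⟨fun x => f x • s x, ContMDiff.smul_section f.contMDiff s.contMDiff⟩⟩

@[simp] theorem Sec.smul_apply (f : SmoothFun n M) (s : Sec n F E) (x : M) :
    (f • s) x = f x • s x := rfl

/-- `Γ(E)` as a module over `C^∞(M)`. -/
instance Sec.instModuleSmoothFun : Module (SmoothFun n M) (Sec n F E) where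
  one_smul s := by ext x; exact one_smul ℝ (s x)
  mul_smul f g s := by ext x; exact mul_smul (f x) (g x) (s x)
  smul_zero f := by ext x; exact smul_zero (f x)
  smul_add f s t := by ext x; exact smul_add (f x) (s x) (t x)
  add_smul f g s := by ext x; exact add_smul (f x) (g x) (s x)
  zero_smul s := by ext x; exact zero_smul ℝ (s x)

/-- Evaluating a smooth family of linear forms on a smooth local section gives a smooth function. -/
theorem contMDiffAt_dual_apply {β : ∀ x, E x →L[ℝ] ℝ} {s : ∀ x, E x} {x₀ : M}
    (hβ : ContMDiffAt (𝓡 n) ((𝓡 n).prod 𝓘(ℝ, F →L[ℝ] ℝ)) ∞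
      (fun x => TotalSpace.mk' (F →L[ℝ] ℝ) (E := fun x => E x →L[ℝ] Trivial M ℝ x) x (β x)) x₀)
    (hs : ContMDiffAt (𝓡 n) ((𝓡 n).prod 𝓘(ℝ, F)) ∞ (fun x => TotalSpace.mk' F x (s x)) x₀) :
    ContMDiffAt (𝓡 n) 𝓘(ℝ, ℝ) ∞ (fun x => β x (s x)) x₀ := by
  have h := ContMDiffAt.clm_bundle_apply (F₂ := ℝ) (E₂ := Trivial M ℝ) (b := id) hβ hs
  simp only [contMDiffAt_totalSpace] at h
  exact h.2

/-- Evaluating a smooth family of bilinear forms on smooth local sections gives a smooth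
function. -/
theorem contMDiffAt_dual_apply₂ {F' : Type*} [NormedAddCommGroup F'] [NormedSpace ℝ F']
    {E' : M → Type*} [∀ x, AddCommGroup (E' x)] [∀ x, Module ℝ (E' x)]
    [∀ x, TopologicalSpace (E' x)] [TopologicalSpace (TotalSpace F' E')] [FiberBundle F' E']
    [VectorBundle ℝ F' E']
    {g : ∀ x, E x →L[ℝ] E' x →L[ℝ] ℝ} {s : ∀ x, E x} {t : ∀ x, E' x} {x₀ : M}
    (hg : ContMDiffAt (𝓡 n) ((𝓡 n).prod 𝓘(ℝ, F →L[ℝ] F' →L[ℝ] ℝ)) ∞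
      (fun x => TotalSpace.mk' (F →L[ℝ] F' →L[ℝ] ℝ)
        (E := fun x => E x →L[ℝ] E' x →L[ℝ] Trivial M ℝ x) x (g x)) x₀)
    (hs : ContMDiffAt (𝓡 n) ((𝓡 n).prod 𝓘(ℝ, F)) ∞ (fun x => TotalSpace.mk' F x (s x)) x₀)
    (ht : ContMDiffAt (𝓡 n) ((𝓡 n).prod 𝓘(ℝ, F')) ∞ (fun x => TotalSpace.mk' F' x (t x)) x₀) :
    ContMDiffAt (𝓡 n) 𝓘(ℝ, ℝ) ∞ (fun x => g x (s x) (t x)) x₀ := by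
  have h := ContMDiffAt.clm_bundle_apply₂ (F₃ := ℝ) (E₃ := Trivial M ℝ) (b := id) hg hs ht
  simp only [contMDiffAt_totalSpace] at h
  exact h.2

variable [FiniteDimensional ℝ F]

/-- A family of linear forms on the fibres of a vector bundle is smooth if its values on local
frames are. -/
theorem contMDiffAt_dual_of_localFrame
    (β : ∀ x, E x →L[ℝ] ℝ) (x₀ : M)
    (h : ∀ i, ContMDiffAt (𝓡 n) 𝓘(ℝ, ℝ) ∞
      (fun y => β y ((trivializationAt F E x₀).localFrame (Module.finBasis ℝ F) i y)) x₀) :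
    ContMDiffAt (𝓡 n) ((𝓡 n).prod 𝓘(ℝ, F →L[ℝ] ℝ)) ∞
      (fun x => TotalSpace.mk' (F →L[ℝ] ℝ) (E := fun x => E x →L[ℝ] Trivial M ℝ x) x (β x)) x₀ := by
  rw [contMDiffAt_hom_bundle]
  refine ⟨contMDiffAt_id, ?_⟩
  set t := trivializationAt F E x₀
  set b := Module.finBasis ℝ F
  have key : ContMDiffAt (𝓡 n) 𝓘(ℝ, F →L[ℝ] ℝ) ∞
      (fun y => ∑ i, β y (t.localFrame b i y) • (b.coord i).toContinuousLinearMap) x₀ := by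
    refine ContMDiffAt.sum fun i _ => ?_
    exact (h i).smul contMDiffAt_const
  refine key.congr_of_eventuallyEq ?_
  filter_upwards [t.open_baseSet.mem_nhds (FiberBundle.mem_baseSet_trivializationAt F E x₀)]
    with y hy
  refine ContinuousLinearMap.coe_injective (b.ext fun i => ?_)
  have h1 : t.localFrame b i y = t.symm y (b i) := by
    rw [t.localFrame_apply_of_mem_baseSet b hy]
    simp [Trivialization.basisAt]
  simp [ContinuousLinearMap.inCoordinates, Finsupp.single_apply, h1, t]
  exact congrArg (β y) (Trivialization.symmL_apply t hy (b i))

variable [ContMDiffVectorBundle ∞ F E (𝓡 n)]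

/-- If a smooth nondegenerate bilinear form turns a section into a smooth family of linear forms,
then the section is smooth. -/
theorem contMDiffAt_of_nondegenerate {g : ∀ x, E x →L[ℝ] E x →L[ℝ] ℝ} {s : ∀ x, E x} {x₀ : M}
    (hg : ContMDiffAt (𝓡 n) ((𝓡 n).prod 𝓘(ℝ, F →L[ℝ] F →L[ℝ] ℝ)) ∞
      (fun x => TotalSpace.mk' (F →L[ℝ] F →L[ℝ] ℝ)
        (E := fun x => E x →L[ℝ] E x →L[ℝ] Trivial M ℝ x) x (g x)) x₀)
    (hnd : ∀ x v, (∀ w, g x v w = 0) → v = 0)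
    (hs : ∀ i, ContMDiffAt (𝓡 n) 𝓘(ℝ, ℝ) ∞ (fun y => g y (s y)
      ((trivializationAt F E x₀).localFrame (Module.finBasis ℝ F) i y)) x₀) :
    ContMDiffAt (𝓡 n) ((𝓡 n).prod 𝓘(ℝ, F)) ∞ (fun x => TotalSpace.mk' F x (s x)) x₀ := by
  have : ContMDiffVectorBundle 1 F E (𝓡 n) := ContMDiffVectorBundle.of_le (n := ∞) (by simp)
  set t := trivializationAt F E x₀
  set b := Module.finBasis ℝ F
  have hx₀ : x₀ ∈ t.baseSet := FiberBundle.mem_baseSet_trivializationAt F E x₀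
  let ι := Fin (Module.finrank ℝ F)
  let e : ι → ∀ x, E x := t.localFrame b
  have he (i : ι) : ContMDiffAt (𝓡 n) ((𝓡 n).prod 𝓘(ℝ, F)) ∞
      (fun x => TotalSpace.mk' F x (e i x)) x₀ := contMDiffAt_localFrame_of_mem ∞ t b i hx₀
  let c : ι → M → ℝ := fun i y => t.localFrameCoeff (𝓡 n) b i y (s y)
  suffices h : ∀ i, ContMDiffAt (𝓡 n) 𝓘(ℝ, ℝ) ∞ (c i) x₀ from
    (contMDiffAt_iff_localFrameCoeff b hx₀).2 h
  let A : M → (ι → ℝ) →L[ℝ] (ι → ℝ) := fun y =>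
    ∑ i, ∑ j, g y (e i y) (e j y) •
      (((LinearMap.proj i : (ι → ℝ) →ₗ[ℝ] ℝ).smulRight
        (Pi.single j (1 : ℝ) : ι → ℝ)).toContinuousLinearMap)
  have hA : ContMDiffAt (𝓡 n) 𝓘(ℝ, (ι → ℝ) →L[ℝ] (ι → ℝ)) ∞ A x₀ :=
    ContMDiffAt.sum fun i _ => ContMDiffAt.sum fun j _ =>
      (contMDiffAt_dual_apply₂ hg (he i) (he j)).smul contMDiffAt_const
  have hA_apply (y : M) (v : ι → ℝ) (j : ι) :
      A y v j = g y (∑ i, v i • e i y) (e j y) := by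
    simp [A, Finset.sum_apply, Pi.single_apply, mul_comm]
  have hinj (y : M) (hy : y ∈ t.baseSet) : Function.Injective (A y) := by
    rw [injective_iff_map_eq_zero]
    intro v hv
    have h0 : ∑ i, v i • e i y = 0 := by
      refine hnd y _ fun w => ?_
      classical
      have hw := t.eq_sum_localFrameCoeff_smul (I := 𝓡 n) (b := b) (s := fun z =>
        if h : z = y then h ▸ w else 0) hy
      simp only [dite_true] at hw
      rw [hw, map_sum]
      refine Finset.sum_eq_zero fun j _ => ?_
      rw [map_smul]
      have := congrFun hv j
      rw [hA_apply] at this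
      have h2 : g y (∑ i, v i • e i y) (t.localFrame b j y) = 0 := this
      rw [h2, smul_zero]
    have hli := (t.isLocalFrameOn_localFrame_baseSet (𝓡 n) 1 b).linearIndependent hy
    exact funext (Fintype.linearIndependent_iff.1 hli v h0)
  let B : (ι → ℝ) ≃L[ℝ] (ι → ℝ) :=
    (LinearEquiv.ofInjectiveEndo (A x₀ : (ι → ℝ) →ₗ[ℝ] (ι → ℝ)) (hinj x₀ hx₀)).toContinuousLinearEquiv
  have hB : (B : (ι → ℝ) →L[ℝ] (ι → ℝ)) = A x₀ := by ext v; rfl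
  have hinv : ContMDiffAt (𝓡 n) 𝓘(ℝ, (ι → ℝ) →L[ℝ] (ι → ℝ)) ∞
      (fun y => (A y).inverse) x₀ := by
    have := (contDiffAt_map_inverse (n := ∞) B).contMDiffAt
    rw [hB] at this
    exact ContMDiffAt.comp x₀ this hA
  let ξ : M → ι → ℝ := fun y j => g y (s y) (e j y)
  have hξ : ContMDiffAt (𝓡 n) 𝓘(ℝ, ι → ℝ) ∞ ξ x₀ := contMDiffAt_pi_space.2 hs
  have hc : ContMDiffAt (𝓡 n) 𝓘(ℝ, ι → ℝ) ∞ (fun y => (A y).inverse (ξ y)) x₀ :=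
    hinv.clm_apply hξ
  intro i
  refine (contMDiffAt_pi_space.1 hc i).congr_of_eventuallyEq ?_
  filter_upwards [t.open_baseSet.mem_nhds hx₀] with y hy
  let By : (ι → ℝ) ≃L[ℝ] (ι → ℝ) :=
    (LinearEquiv.ofInjectiveEndo (A y : (ι → ℝ) →ₗ[ℝ] (ι → ℝ)) (hinj y hy)).toContinuousLinearEquiv
  have hBy : (By : (ι → ℝ) →L[ℝ] (ι → ℝ)) = A y := by ext v; rfl
  have h3 : By (fun i => c i y) = ξ y := by
    change A y (fun i => c i y) = ξ y
    ext j
    rw [hA_apply]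
    have := t.eq_sum_localFrameCoeff_smul (I := 𝓡 n) (b := b) (s := s) hy
    change g y (∑ i, c i y • t.localFrame b i y) (e j y) = g y (s y) (e j y)
    rw [← this]
  change c i y = (A y).inverse (ξ y) i
  rw [← hBy, ContinuousLinearMap.inverse_equiv, ← h3]
  simp

end Bundle

section Forms

variable [IsManifold (𝓡 n) ∞ M]

/-- The differential of a function that is smooth near a point is a smooth family of covectors. -/
theorem contMDiffAt_mvfderiv {f : M → ℝ} {x₀ : M} (hf : ContMDiffAt (𝓡 n) 𝓘(ℝ, ℝ) ∞ f x₀) :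
    ContMDiffAt (𝓡 n) ((𝓡 n).prod 𝓘(ℝ, EuclideanSpace ℝ (Fin n) →L[ℝ] ℝ)) ∞
      (fun x => TotalSpace.mk' (EuclideanSpace ℝ (Fin n) →L[ℝ] ℝ)
        (E := fun x : M => TangentSpace (𝓡 n) x →L[ℝ] Trivial M ℝ x) x (mvfderiv (𝓡 n) f x)) x₀ := by
  rw [contMDiffAt_hom_bundle]
  refine ⟨contMDiffAt_id, ?_⟩
  have h := hf.mfderiv_const (m := ∞) le_rfl
  refine h.congr_of_eventuallyEq (Filter.Eventually.of_forall fun y => ?_)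
  ext v
  simp [inTangentCoordinates, ContinuousLinearMap.inCoordinates, mvfderiv]
  rfl

/-- The exterior derivative `df ∈ Ω¹` of a smooth function. -/
def dForm (f : SmoothFun n M) : OneForm n M :=
  ⟨fun x => mvfderiv (𝓡 n) f x, fun x => contMDiffAt_mvfderiv (f.contMDiff x)⟩

/-- The function `α(X)`. -/
def OneForm.eval (α : OneForm n M) (X : VecField n M) : SmoothFun n M :=
  ⟨fun x => α x (X x), fun x => contMDiffAt_dual_apply (α.contMDiff x) (X.contMDiff x)⟩

/-- The value of `dα(X, Y) = X(α(Y)) - Y(α(X)) - α([X, Y])` at the point `x`. -/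
def dOneFormAt (α : OneForm n M) (X : VecField n M) (x : M)
    (Y : ∀ y : M, TangentSpace (𝓡 n) y) : ℝ :=
  mvfderiv (𝓡 n) (fun y => α y (Y y)) x (X x) - mvfderiv (𝓡 n) (fun y => α y (X y)) x (Y x)
    - α x (VectorField.mlieBracket (𝓡 n) (fun y => X y) Y x)

theorem mdifferentiableAt_oneForm_apply (α : OneForm n M) {x : M}
    {Y : ∀ y : M, TangentSpace (𝓡 n) y}
    (hY : MDifferentiableAt (𝓡 n) ((𝓡 n).prod 𝓘(ℝ, EuclideanSpace ℝ (Fin n)))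
      (fun y => TotalSpace.mk' (EuclideanSpace ℝ (Fin n)) y (Y y)) x) :
    MDifferentiableAt (𝓡 n) 𝓘(ℝ, ℝ) (fun y => α y (Y y)) x := by
  have h := MDifferentiableAt.clm_bundle_apply (F₂ := ℝ) (E₂ := Trivial M ℝ) (b := id)
    (ϕ := fun y => α y) (α.mdifferentiableAt (x := x)) hY
  simp only [mdifferentiableAt_totalSpace] at h
  exact h.2

theorem dOneFormAt_tensorial (α : OneForm n M) (X : VecField n M) (x : M) :
    TensorialAt (𝓡 n) (EuclideanSpace ℝ (Fin n)) (dOneFormAt α X x) x where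
  smul {f Y} hf hY := by
    have h1 : (fun y => α y ((f • Y) y)) = f * (fun y => α y (Y y)) := by
      ext y; simp
    have h2 : mvfderiv (𝓡 n) (fun y => α y ((f • Y) y)) x (X x) =
        f x * mvfderiv (𝓡 n) (fun y => α y (Y y)) x (X x) +
          mvfderiv (𝓡 n) f x (X x) * α x (Y x) := by
      rw [h1, mvfderiv_mul hf (mdifferentiableAt_oneForm_apply α hY)]
      simp [mul_comm]
    simp only [dOneFormAt, h2]
    rw [VectorField.mlieBracket_smul_right hf hY]
    simp
    ring
  add {Y Y'} hY hY' := by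
    have h1 : (fun y => α y ((Y + Y') y)) = (fun y => α y (Y y)) + (fun y => α y (Y' y)) := by
      ext y; simp
    simp only [dOneFormAt, h1]
    rw [VectorField.mlieBracket_add_right hY hY', mvfderiv_add
      (mdifferentiableAt_oneForm_apply α hY) (mdifferentiableAt_oneForm_apply α hY')]
    simp
    ring

/-- The contraction `i_X dα ∈ Ω¹`, whose value on a vector field `Y` is
`dα(X, Y) = X(α(Y)) - Y(α(X)) - α([X, Y])`. -/
def iotaD (X : VecField n M) (α : OneForm n M) : OneForm n M where
  toFun x := TensorialAt.mkHom (dOneFormAt α X x) x (dOneFormAt_tensorial α X x)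
  contMDiff_toFun x₀ := by
    refine contMDiffAt_dual_of_localFrame _ x₀ fun i => ?_
    set t := trivializationAt (EuclideanSpace ℝ (Fin n)) (TangentSpace (𝓡 n) : M → Type _) x₀
    set b := Module.finBasis ℝ (EuclideanSpace ℝ (Fin n))
    have hx₀ : x₀ ∈ t.baseSet := FiberBundle.mem_baseSet_trivializationAt _ _ x₀
    have he {y : M} (hy : y ∈ t.baseSet) :
        ContMDiffAt (𝓡 n) ((𝓡 n).prod 𝓘(ℝ, EuclideanSpace ℝ (Fin n))) ∞
          (fun y => TotalSpace.mk' (EuclideanSpace ℝ (Fin n)) y (t.localFrame b i y)) y :=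
      contMDiffAt_localFrame_of_mem ∞ t b i hy
    have h1 : ContMDiffAt (𝓡 n) 𝓘(ℝ, ℝ) ∞
        (fun y => dOneFormAt α X y (t.localFrame b i)) x₀ := by
      refine ContMDiffAt.sub (ContMDiffAt.sub ?_ ?_) ?_
      · exact contMDiffAt_dual_apply (contMDiffAt_mvfderiv
          (contMDiffAt_dual_apply (α.contMDiff x₀) (he hx₀))) (X.contMDiff x₀)
      · exact contMDiffAt_dual_apply (contMDiffAt_mvfderiv
          (contMDiffAt_dual_apply (α.contMDiff x₀) (X.contMDiff x₀))) (he hx₀)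
      · refine contMDiffAt_dual_apply (α.contMDiff x₀) ?_
        have : IsManifold (𝓡 n) (minSmoothness ℝ 2) M := by
          rw [minSmoothness_of_isRCLikeNormedField]; infer_instance
        have : IsManifold (𝓡 n) (minSmoothness ℝ 3) M := by
          rw [minSmoothness_of_isRCLikeNormedField]; infer_instance
        have : IsManifold (𝓡 n) ((∞ : WithTop ℕ∞) + 1) M := inferInstanceAs (IsManifold (𝓡 n) ∞ M)
        exact ContMDiffAt.mlieBracket_vectorField (m := ⊤) (n := ⊤) (X.contMDiff x₀) (he hx₀)
          (by simp)
    refine h1.congr_of_eventuallyEq ?_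
    filter_upwards [t.open_baseSet.mem_nhds hx₀] with y hy
    exact TensorialAt.mkHom_apply _ ((he hy).mdifferentiableAt (by simp))

theorem iotaD_apply (X Y : VecField n M) (α : OneForm n M) (x : M) :
    iotaD X α x (Y x) = mvfderiv (𝓡 n) (α.eval Y) x (X x) - mvfderiv (𝓡 n) (α.eval X) x (Y x)
      - α x (VectorField.mlieBracket (𝓡 n) (fun y => X y) (fun y => Y y) x) :=
  TensorialAt.mkHom_apply (dOneFormAt_tensorial α X x) Y.mdifferentiableAt

end Forms

/-! ### Courant algebroids, preduals and Dorfman connections -/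

section Courant

variable [IsManifold (𝓡 n) ∞ M]

/-- A vector bundle `E → M` with a smooth fibrewise nondegenerate symmetric bilinear form and an
anchor, i.e. a smooth vector bundle map `ρ : E → TM`. -/
structure AnchoredMetricBundle (n : ℕ) (M : Type*) [TopologicalSpace M]
    [ChartedSpace (EuclideanSpace ℝ (Fin n)) M] [IsManifold (𝓡 n) ∞ M]
    (F : Type*) [NormedAddCommGroup F] [NormedSpace ℝ F] (E : M → Type*)
    [∀ x, AddCommGroup (E x)] [∀ x, Module ℝ (E x)] [∀ x, TopologicalSpace (E x)]
    [TopologicalSpace (TotalSpace F E)] [FiberBundle F E] [VectorBundle ℝ F E] where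
  metric : ∀ x, E x →L[ℝ] E x →L[ℝ] ℝ
  metric_smooth : ContMDiff (𝓡 n) ((𝓡 n).prod 𝓘(ℝ, F →L[ℝ] F →L[ℝ] ℝ)) ∞
    (fun x => TotalSpace.mk' (F →L[ℝ] F →L[ℝ] ℝ) (E := fun x => E x →L[ℝ] E x →L[ℝ] ℝ) x (metric x))
  metric_symm : ∀ x (v w : E x), metric x v w = metric x w v
  metric_nondegenerate : ∀ x (v : E x), (∀ w : E x, metric x v w = 0) → v = 0
  anchor : ∀ x, E x →L[ℝ] TangentSpace (𝓡 n) x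
  anchor_smooth : ContMDiff (𝓡 n) ((𝓡 n).prod 𝓘(ℝ, F →L[ℝ] EuclideanSpace ℝ (Fin n))) ∞
    (fun x => TotalSpace.mk' (F →L[ℝ] EuclideanSpace ℝ (Fin n))
      (E := fun x => E x →L[ℝ] TangentSpace (𝓡 n) x) x (anchor x))

namespace AnchoredMetricBundle

variable {F : Type*} [NormedAddCommGroup F] [NormedSpace ℝ F]
  {E : M → Type*} [∀ x, AddCommGroup (E x)] [∀ x, Module ℝ (E x)] [∀ x, TopologicalSpace (E x)]
  [TopologicalSpace (TotalSpace F E)] [FiberBundle F E] [VectorBundle ℝ F E]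
  (𝒜 : AnchoredMetricBundle n M F E)

/-- The function `⟨e₁, e₂⟩`. -/
def inner (e₁ e₂ : Sec n F E) : SmoothFun n M :=
  ⟨fun x => 𝒜.metric x (e₁ x) (e₂ x), fun x =>
    contMDiffAt_dual_apply₂ (𝒜.metric_smooth x) (e₁.contMDiff x) (e₂.contMDiff x)⟩

/-- The vector field `ρ(e)`. -/
def rho (e : Sec n F E) : VecField n M :=
  ⟨fun x => 𝒜.anchor x (e x),
    ContMDiff.clm_bundle_apply (b := id) 𝒜.anchor_smooth e.contMDiff⟩

/-- The function `ρ(e)(f)`. -/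
def deriv (e : Sec n F E) (f : SmoothFun n M) : SmoothFun n M :=
  (dForm f).eval (𝒜.rho e)

variable [FiniteDimensional ℝ F]

/-- `v ↦ ⟨v, ·⟩` is an isomorphism of each fibre with its dual. -/
theorem metric_bijective (x : M) : Function.Bijective (fun v : E x => (𝒜.metric x v : E x →ₗ[ℝ] ℝ)) := by
  have : FiniteDimensional ℝ (E x) := VectorBundle.finiteDimensional ℝ F E x
  let L : E x →ₗ[ℝ] Module.Dual ℝ (E x) :=
    { toFun v := (𝒜.metric x v : E x →ₗ[ℝ] ℝ)
      map_add' v w := by ext; simp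
      map_smul' c v := by ext; simp }
  have hinj : Function.Injective L := by
    rw [injective_iff_map_eq_zero]
    exact fun v hv => 𝒜.metric_nondegenerate x v fun w => LinearMap.congr_fun hv w
  exact ⟨hinj, (LinearMap.injective_iff_surjective_of_finrank_eq_finrank
    Subspace.dual_finrank_eq.symm).1 hinj⟩

variable [ContMDiffVectorBundle ∞ F E (𝓡 n)]

/-- The section `ρ*(α)` of `E ≅ E*`, i.e. the section with `⟨ρ*(α), e⟩ = α(ρ(e))`. -/
def rhoStar (α : OneForm n M) : Sec n F E where
  toFun x := ((𝒜.metric_bijective x).2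
    ((α x : TangentSpace (𝓡 n) x →ₗ[ℝ] ℝ) ∘ₗ (𝒜.anchor x : E x →ₗ[ℝ] TangentSpace (𝓡 n) x))).choose
  contMDiff_toFun x₀ := by
    refine contMDiffAt_of_nondegenerate (𝒜.metric_smooth x₀) 𝒜.metric_nondegenerate fun i => ?_
    have he := contMDiffAt_localFrame_of_mem (I := 𝓡 n) ∞ (trivializationAt F E x₀)
      (Module.finBasis ℝ F) i (FiberBundle.mem_baseSet_trivializationAt F E x₀)
    have h := contMDiffAt_dual_apply (α.contMDiff x₀)
      (ContMDiffAt.clm_bundle_apply (b := id) (𝒜.anchor_smooth x₀) he)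
    refine h.congr_of_eventuallyEq (Filter.Eventually.of_forall fun y => ?_)
    exact LinearMap.congr_fun ((𝒜.metric_bijective y).2
      ((α y : TangentSpace (𝓡 n) y →ₗ[ℝ] ℝ) ∘ₗ
        (𝒜.anchor y : E y →ₗ[ℝ] TangentSpace (𝓡 n) y))).choose_spec _

theorem metric_rhoStar (α : OneForm n M) (x : M) (v : E x) :
    𝒜.metric x (𝒜.rhoStar α x) v = α x (𝒜.anchor x v) :=
  LinearMap.congr_fun ((𝒜.metric_bijective x).2
      ((α x : TangentSpace (𝓡 n) x →ₗ[ℝ] ℝ) ∘ₗ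
        (𝒜.anchor x : E x →ₗ[ℝ] TangentSpace (𝓡 n) x))).choose_spec v

/-- The operator `d_E = ρ* ∘ d : C^∞(M) → Γ(E)`, so that `⟨d_E f, e⟩ = ρ(e)(f)`. -/
def dE (f : SmoothFun n M) : Sec n F E := 𝒜.rhoStar (dForm f)

theorem inner_dE (f : SmoothFun n M) (e : Sec n F E) : 𝒜.inner (𝒜.dE f) e = 𝒜.deriv e f := by
  ext x
  exact 𝒜.metric_rhoStar (dForm f) x (e x)

end AnchoredMetricBundle

/-- A Courant algebroid over the smooth manifold `M`. -/
structure CourantAlgebroid (n : ℕ) (M : Type*) [TopologicalSpace M]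
    [ChartedSpace (EuclideanSpace ℝ (Fin n)) M] [IsManifold (𝓡 n) ∞ M]
    (F : Type*) [NormedAddCommGroup F] [NormedSpace ℝ F] [FiniteDimensional ℝ F] (E : M → Type*)
    [∀ x, AddCommGroup (E x)] [∀ x, Module ℝ (E x)] [∀ x, TopologicalSpace (E x)]
    [TopologicalSpace (TotalSpace F E)] [FiberBundle F E] [VectorBundle ℝ F E]
    [ContMDiffVectorBundle ∞ F E (𝓡 n)] extends AnchoredMetricBundle n M F E where
  bracket : Sec n F E →ₗ[ℝ] Sec n F E →ₗ[ℝ] Sec n F E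
  jacobi : ∀ e₁ e₂ e₃ : Sec n F E,
    bracket e₁ (bracket e₂ e₃) = bracket (bracket e₁ e₂) e₃ + bracket e₂ (bracket e₁ e₃)
  deriv_inner : ∀ e₁ e₂ e₃ : Sec n F E,
    toAnchoredMetricBundle.deriv e₁ (toAnchoredMetricBundle.inner e₂ e₃) =
      toAnchoredMetricBundle.inner (bracket e₁ e₂) e₃ +
        toAnchoredMetricBundle.inner e₂ (bracket e₁ e₃)
  bracket_add_swap : ∀ e₁ e₂ : Sec n F E,
    bracket e₁ e₂ + bracket e₂ e₁ =
      toAnchoredMetricBundle.dE (toAnchoredMetricBundle.inner e₁ e₂)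

variable {F : Type*} [NormedAddCommGroup F] [NormedSpace ℝ F] [FiniteDimensional ℝ F]
  {E : M → Type*} [∀ x, AddCommGroup (E x)] [∀ x, Module ℝ (E x)] [∀ x, TopologicalSpace (E x)]
  [TopologicalSpace (TotalSpace F E)] [FiberBundle F E] [VectorBundle ℝ F E]
  [ContMDiffVectorBundle ∞ F E (𝓡 n)]
  {FB : Type*} [NormedAddCommGroup FB] [NormedSpace ℝ FB]
  {B : M → Type*} [∀ x, AddCommGroup (B x)] [∀ x, Module ℝ (B x)] [∀ x, TopologicalSpace (B x)]
  [TopologicalSpace (TotalSpace FB B)] [FiberBundle FB B] [VectorBundle ℝ FB B]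

/-- A predual of the Courant algebroid `E`: a vector bundle `B` with a smooth fibrewise bilinear
pairing of `E` and `B` and a map `d_B : C^∞(M) → Γ(B)` such that `d_B f` pairs with `e` to
`ρ(e)(f)`. -/
structure Predual (𝒜 : CourantAlgebroid n M F E) (FB : Type*) [NormedAddCommGroup FB]
    [NormedSpace ℝ FB] (B : M → Type*) [∀ x, AddCommGroup (B x)] [∀ x, Module ℝ (B x)]
    [∀ x, TopologicalSpace (B x)] [TopologicalSpace (TotalSpace FB B)] [FiberBundle FB B]
    [VectorBundle ℝ FB B] where
  pairing : ∀ x, E x →L[ℝ] B x →L[ℝ] ℝ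
  pairing_smooth : ContMDiff (𝓡 n) ((𝓡 n).prod 𝓘(ℝ, F →L[ℝ] FB →L[ℝ] ℝ)) ∞
    (fun x => TotalSpace.mk' (F →L[ℝ] FB →L[ℝ] ℝ)
      (E := fun x => E x →L[ℝ] B x →L[ℝ] ℝ) x (pairing x))
  dB : SmoothFun n M → Sec n FB B
  pairing_dB : ∀ (e : Sec n F E) (f : SmoothFun n M) (x : M),
    pairing x (e x) (dB f x) = 𝒜.deriv e f x

/-- The function obtained by pairing a section of `E` with a section of the predual `B`. -/
def Predual.pair {𝒜 : CourantAlgebroid n M F E} (P : Predual 𝒜 FB B) (e : Sec n F E)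
    (b : Sec n FB B) : SmoothFun n M :=
  ⟨fun x => P.pairing x (e x) (b x), fun x =>
    contMDiffAt_dual_apply₂ (P.pairing_smooth x) (e.contMDiff x) (b.contMDiff x)⟩

/-- An `E`-Dorfman connection on the predual `B`. -/
structure DorfmanConnection {𝒜 : CourantAlgebroid n M F E} (P : Predual 𝒜 FB B) where
  nabla : Sec n F E →ₗ[ℝ] Sec n FB B →ₗ[ℝ] Sec n FB B
  nabla_smul_left : ∀ (f : SmoothFun n M) (e : Sec n F E) (b : Sec n FB B),
    nabla (f • e) b = f • nabla e b + P.pair e b • P.dB f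
  nabla_smul_right : ∀ (e : Sec n F E) (f : SmoothFun n M) (b : Sec n FB B),
    nabla e (f • b) = f • nabla e b + 𝒜.deriv e f • b
  nabla_dB : ∀ (e : Sec n F E) (f : SmoothFun n M), nabla e (P.dB f) = P.dB (𝒜.deriv e f)

end Courant

/-! ### Cochains -/

section Cochains

variable [IsManifold (𝓡 n) ∞ M]
  {F : Type*} [NormedAddCommGroup F] [NormedSpace ℝ F]
  {E : M → Type*} [∀ x, AddCommGroup (E x)] [∀ x, Module ℝ (E x)] [∀ x, TopologicalSpace (E x)]
  [TopologicalSpace (TotalSpace F E)] [FiberBundle F E] [VectorBundle ℝ F E]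
  {W : Type*} [AddCommGroup W]

/-- Families `η = (η_{j,k})` of functions of `j` sections `e₁, …, e_j` of `E` and `k` one-forms
`α₁, …, α_k` with values in `W`. A cochain `(η₀, η₁, …)` of degree `p` is such a family whose
component `η_k` is the entry with `j = p - 2k`, all entries with `j + 2k ≠ p` being zero. -/
abbrev Cochain (n : ℕ) {M : Type*} [TopologicalSpace M]
    [ChartedSpace (EuclideanSpace ℝ (Fin n)) M] [IsManifold (𝓡 n) ∞ M]
    (F : Type*) [NormedAddCommGroup F] [NormedSpace ℝ F] (E : M → Type*)
    [TopologicalSpace (TotalSpace F E)] [∀ x, TopologicalSpace (E x)] [FiberBundle F E]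
    (W : Type*) :=
  ∀ j k : ℕ, (Fin j → Sec n F E) → (Fin k → OneForm n M) → W

/-- Differential operators of order at most `s` between modules over an algebra `R`: those whose
symbols `v ↦ P (f v) - f P v` have order at most `s - 1`, order `0` meaning vanishing symbols.
(Linearity over the ground field is required separately.) -/
def IsDiffOp (R : Type*) [CommRing R] {V W : Type*} [AddCommGroup V] [Module R V] [AddCommGroup W]
    [Module R W] : ℕ → (V → W) → Prop
  | 0, P => ∀ (f : R) (v : V), P (f • v) - f • P v = 0
  | s + 1, P => ∀ f : R, IsDiffOp R s (fun v => P (f • v) - f • P v)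

open Function (update)

/-- The space `𝔇^p_{m,m-1}(E; W)` of `p`-cochains with values in the `C^∞(M)`-module `W` that are
differential operators of order at most `m` in each one-form and in each section argument but the
last one, and of order at most `m - 1` in the last section argument; if `p = 1` the only argument
counts as a first argument. The case `W = C^∞(M)` is `𝔇^p_{m,m-1}`. For `p < 0` the only element
is `0`. -/
structure IsDiffCochain [Module ℝ W] [Module (SmoothFun n M) W] (𝒜 : AnchoredMetricBundle n M F E)
    (p : ℤ) (m : ℕ) (η : Cochain n F E W) : Prop where
  degree : ∀ j k : ℕ, (j : ℤ) + 2 * k ≠ p → η j k = 0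
  map_update_add : ∀ j k es αs (i : Fin j) (e e' : Sec n F E),
    η j k (update es i (e + e')) αs = η j k (update es i e) αs + η j k (update es i e') αs
  map_update_smul : ∀ j k es αs (i : Fin j) (c : ℝ) (e : Sec n F E),
    η j k (update es i (c • e)) αs = c • η j k (update es i e) αs
  map_form_update_add : ∀ j k es αs (i : Fin k) (α α' : OneForm n M),
    η j k es (update αs i (α + α')) = η j k es (update αs i α) + η j k es (update αs i α')
  map_form_update_smul : ∀ j k es αs (i : Fin k) (c : ℝ) (α : OneForm n M),
    η j k es (update αs i (c • α)) = c • η j k es (update αs i α)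
  form_symm : ∀ j k es αs (σ : Equiv.Perm (Fin k)), η j k es (αs ∘ σ) = η j k es αs
  -- `η_k(…, e_i, e_{i+1}, …; …) + η_k(…, e_{i+1}, e_i, …; …) = -η_{k+1}(…; d⟨e_i, e_{i+1}⟩, …)`
  add_swap : ∀ j k (es : Fin (j + 2) → Sec n F E) αs (i : Fin (j + 1)),
    η (j + 2) k es αs + η (j + 2) k (es ∘ Equiv.swap i.castSucc i.succ) αs =
      - η j (k + 1) (i.removeNth (i.castSucc.removeNth es))
          (Fin.cons (dForm (𝒜.inner (es i.castSucc) (es i.succ))) αs)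
  order_form : ∀ j k es αs (i : Fin k),
    IsDiffOp (SmoothFun n M) m (fun α : OneForm n M => η j k es (update αs i α))
  order_arg : ∀ j k es αs (i : Fin j), (i : ℕ) + 1 < j →
    IsDiffOp (SmoothFun n M) m (fun e : Sec n F E => η j k (update es i e) αs)
  order_last : ∀ j k es αs (i : Fin j), (i : ℕ) + 1 = j →
    IsDiffOp (SmoothFun n M) (if p = 1 then m else m - 1)
      (fun e : Sec n F E => η j k (update es i e) αs)

/-- Contraction `i_e` with a section of `E`. -/
def iSec (e : Sec n F E) (η : Cochain n F E W) : Cochain n F E W :=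
  fun j k es αs => η (j + 1) k (Fin.cons e es) αs

/-- Contraction `i_α` with a one-form. -/
def iForm (α : OneForm n M) (η : Cochain n F E W) : Cochain n F E W :=
  fun j k es αs => η j (k + 1) es (Fin.cons α αs)

/-- Contraction `i_f = i_{df}` with a function. -/
def iFun (f : SmoothFun n M) (η : Cochain n F E W) : Cochain n F E W := iForm (dForm f) η

/-- The element `η ⊗ b` of `𝔇 ⊗ Γ ≅ 𝔇(E; Γ)`. -/
def Cochain.tensor [SMul (SmoothFun n M) W] (η : Cochain n F E (SmoothFun n M)) (b : W) :
    Cochain n F E W :=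
  fun j k es αs => η j k es αs • b

/-- An element of `W` as a cochain of degree `0`. -/
def Cochain.ofElem (b : W) : Cochain n F E W
  | 0, 0 => fun _ _ => b
  | _, _ => 0

/-- The signature of the shuffle that moves the elements of `S`, in increasing order, in front of
the elements of its complement. -/
def shuffleSign {j : ℕ} (S : Finset (Fin j)) : ℤ :=
  (-1) ^ ((S ×ˢ Sᶜ).filter fun a => a.2 < a.1).card

/-- The product `η · H` of a scalar cochain and a `W`-valued cochain, with
`(η · H)_k(e₁, …; α₁, …)` the signed sum over all shuffles of the `e`s and all shuffles of the
`α`s; shuffles are indexed by the sets of those positions that go to `η`. -/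
def Cochain.mul [SMul (SmoothFun n M) W] (η : Cochain n F E (SmoothFun n M))
    (H : Cochain n F E W) : Cochain n F E W :=
  fun j k es αs => ∑ S : Finset (Fin j), ∑ T : Finset (Fin k),
    shuffleSign S •
      (η S.card T.card (es ∘ S.orderEmbOfFin rfl) (αs ∘ T.orderEmbOfFin rfl) •
        H Sᶜ.card Tᶜ.card (es ∘ Sᶜ.orderEmbOfFin rfl) (αs ∘ Tᶜ.orderEmbOfFin rfl))

/-- The graded commutator `{P, Q} = P ∘ Q - (-1)^{pq} Q ∘ P` of operators of degrees `p` and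
`q`. -/
def gradedComm {A : Type*} [AddCommGroup A] (p q : ℤ) (P Q : A → A) : A → A :=
  fun η => P (Q η) - (p * q).negOnePow • Q (P η)

variable [FiniteDimensional ℝ F] [ContMDiffVectorBundle ∞ F E (𝓡 n)]

/-- First part of the differential: `∑_μ η_{k-1}(ρ*(α_μ), e₁, …; α₁, …, α̂_μ, …, α_k)`. -/
def diffPartForm (𝒜 : CourantAlgebroid n M F E) (η : Cochain n F E W) : Cochain n F E W
  | _, 0 => 0
  | j, k + 1 => fun es αs =>
      ∑ μ : Fin (k + 1), η (j + 1) k (Fin.cons (𝒜.rhoStar (αs μ)) es) (μ.removeNth αs)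

/-- Second part of the differential:
`∑_i (-1)^{i-1} (D_{e_i}(η_k(…, ê_i, …; α₁, …)) - ∑_μ η_k(…, ê_i, …; …, i_{ρ(e_i)} dα_μ, …))`. -/
def diffPartDeriv (𝒜 : CourantAlgebroid n M F E) (D : Sec n F E → W → W) (η : Cochain n F E W) :
    Cochain n F E W
  | 0, _ => 0
  | j + 1, k => fun es αs =>
      ∑ i : Fin (j + 1), (-1 : ℤ) ^ (i : ℕ) •
        (D (es i) (η j k (i.removeNth es) αs) -
          ∑ μ : Fin k,
            η j k (i.removeNth es) (update αs μ (iotaD (𝒜.rho (es i)) (αs μ))))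

/-- Third part of the differential:
`∑_{i<l} (-1)^i η_k(…, ê_i, …, e_{l-1}, [e_i, e_l], e_{l+1}, …; α₁, …)`. -/
def diffPartBracket (𝒜 : CourantAlgebroid n M F E) (η : Cochain n F E W) : Cochain n F E W
  | 0, _ => 0
  | j + 1, k => fun es αs =>
      ∑ i : Fin (j + 1), ∑ l ∈ Finset.Ioi i, (-1 : ℤ) ^ ((i : ℕ) + 1) •
        η j k (i.removeNth (update es l (𝒜.bracket (es i) (es l)))) αs

/-- The differential on `W`-valued cochains determined by the action `D` of `Γ(E)` on `W`. -/
def cochainDiff (𝒜 : CourantAlgebroid n M F E) (D : Sec n F E → W → W) (η : Cochain n F E W) :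
    Cochain n F E W :=
  diffPartForm 𝒜 η + diffPartDeriv 𝒜 D η + diffPartBracket 𝒜 η

/-- The differential `d` on scalar cochains, with `Γ(E)` acting on functions through the anchor. -/
def CourantAlgebroid.d (𝒜 : CourantAlgebroid n M F E) (η : Cochain n F E (SmoothFun n M)) :
    Cochain n F E (SmoothFun n M) :=
  cochainDiff 𝒜 (fun e f => 𝒜.deriv e f) η

/-- The Lie derivative `𝓛_e = {i_e, d}` on scalar cochains. -/
def CourantAlgebroid.lieSec (𝒜 : CourantAlgebroid n M F E) (e : Sec n F E) :
    Cochain n F E (SmoothFun n M) → Cochain n F E (SmoothFun n M) :=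
  gradedComm (-1) 1 (iSec e) 𝒜.d

variable {FB : Type*} [NormedAddCommGroup FB] [NormedSpace ℝ FB]
  {B : M → Type*} [∀ x, AddCommGroup (B x)] [∀ x, Module ℝ (B x)] [∀ x, TopologicalSpace (B x)]
  [TopologicalSpace (TotalSpace FB B)] [FiberBundle FB B] [VectorBundle ℝ FB B]
  {𝒜 : CourantAlgebroid n M F E} {P : Predual 𝒜 FB B}

/-- The Dorfman covariant derivative `d^∇` on `Γ(B)`-valued cochains. -/
def DorfmanConnection.d (C : DorfmanConnection P) (H : Cochain n F E (Sec n FB B)) :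
    Cochain n F E (Sec n FB B) :=
  cochainDiff 𝒜 (fun e b => C.nabla e b) H

/-- The operator `∇_e = {i_e, d^∇}` on `Γ(B)`-valued cochains. -/
def DorfmanConnection.nablaOp (C : DorfmanConnection P) (e : Sec n F E) :
    Cochain n F E (Sec n FB B) → Cochain n F E (Sec n FB B) :=
  gradedComm (-1) 1 (iSec e) C.d

/-- The operator `𝓛^∇_f = {i_f, d^∇}` on `Γ(B)`-valued cochains. -/
def DorfmanConnection.lieFun (C : DorfmanConnection P) (f : SmoothFun n M) :
    Cochain n F E (Sec n FB B) → Cochain n F E (Sec n FB B) :=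
  gradedComm (-2) 1 (iFun f) C.d

end Cochains

end Geometry

end

noncomputable section

/-! ### Global sections through a given vector, and the Lie bracket as a commutator of derivations
-/

section Geometry

/-! The proof rests on Cartan's formula, read as a recursion in the number of sections. Let `lieD`
be the explicit Lie derivative of a cochain: differentiate the value by `D e`, then subtract the
terms in which a one-form is replaced by its Lie derivative along ρ(e) or a section e' by [e, e'].
Then i_e d = L_e - d i_e (`cochainDiff_cons`). The formula for d contains i_{ρ(e)}dα where L_e needs
the full Lie derivative of α; the missing term d(α(ρ(e))) appears when ρ*α is moved past e by the
swap relation, because ⟨ρ*α, e⟩ = α(ρ(e)).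

With this recursion every property of dH follows by induction on the number of sections from the
same property of L_e H and of d on components without sections, where only the ρ*-part survives. L_e
preserves orders, since it is built from commutators of differential operators with derivations over
the same derivation ρ(e) of C^∞(M), and such a commutator has no larger order than the operator
(`IsDiffOp.lie`). It preserves the swap relation because the metric is invariant and L_X df =
d(X(f)). For d itself the swap relation follows from i_e i_e' + i_e' i_e = -i_f with f = ⟨e, e'⟩,
from [e, e'] + [e', e] = d_E f, and from i_f d = d i_f + i_{d_E f} (`iFun_cochainDiff`), which holds
because d(df) = 0.

For part (b) the class of cochains is relaxed to `IsOrderCochain`, which ignores the degree and has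
separate bounds for the last section and for the other arguments. The differential takes bounds (m,
m) to (m + 1, m): only the first argument fed to the recursion can gain an order, and not when it is
also the last one. This yields ∇_e as a sum of two such terms, while 𝓛^∇_f is simply i_{d_E f}.

The Leibniz rule is a termwise computation: only the derivative part of d^∇ sees b, and its extra
terms are collected in `tensorNabla`. These equal (-1)^p ω · d^∇b because d^∇b has a single
component, with one section and no one-forms, so that only the shuffles leaving out one position
contribute. Contracting the Leibniz rule with e gives the formula for ∇_e. -/

theorem two_le_infty : (2 : WithTop ℕ∞) ≤ ∞ :=
  WithTop.coe_le_coe.2 (le_top : (2 : ℕ∞) ≤ ⊤)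

variable {n : ℕ} {M : Type*} [TopologicalSpace M] [ChartedSpace (EuclideanSpace ℝ (Fin n)) M]
  [IsManifold (𝓡 n) ∞ M]

/-- On a Hausdorff manifold, every vector in a fibre of a vector bundle is the value of a smooth
global section. -/
theorem exists_sec_apply_eq [T2Space M] {F : Type*} [NormedAddCommGroup F] [NormedSpace ℝ F]
    {E : M → Type*} [∀ x, AddCommGroup (E x)] [∀ x, Module ℝ (E x)] [∀ x, TopologicalSpace (E x)]
    [TopologicalSpace (TotalSpace F E)] [FiberBundle F E] [VectorBundle ℝ F E]
    [ContMDiffVectorBundle ∞ F E (𝓡 n)] (x : M) (v : E x) :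
    ∃ s : Sec n F E, s x = v := by
  obtain ⟨u, hu, hs⟩ := FiberBundle.exists_contMDiffOn_extend (k := ∞) (𝓡 n) F v
  obtain ⟨u', hu', hou', hx⟩ := mem_nhds_iff.1 hu
  obtain ⟨f, hf⟩ := (SmoothBumpFunction.nhds_basis_tsupport (I := 𝓡 n) x).mem_iff.1
    (hou'.mem_nhds hx)
  -- A local extension of v is cut off by a bump function supported where the extension is smooth.
  -- Off the closed support the product vanishes on a neighbourhood, so smoothness is checked
  -- separately on the support and off it.
  refine ⟨⟨fun y => f y • FiberBundle.extend F v y, fun y => ?_⟩, ?_⟩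
  · by_cases hy : y ∈ tsupport f
    · exact f.contMDiffAt.smul_section ((hs y (hu' (hf.2 hy))).contMDiffAt
        (Filter.mem_of_superset (hou'.mem_nhds (hf.2 hy)) hu'))
    · have h0 := contMDiff_zeroSection ℝ E (IB := 𝓡 n) (F := F) (n := ∞) y
      refine h0.congr_of_eventuallyEq ?_
      filter_upwards [(isClosed_tsupport f).isOpen_compl.mem_nhds hy] with z hz
      have : f z = 0 := image_eq_zero_of_notMem_tsupport hz
      simp [this, zeroSection]
  · change f x • FiberBundle.extend F v x = v
    rw [f.eq_one, one_smul, FiberBundle.extend_apply_self]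

omit [IsManifold (𝓡 n) ∞ M] in
theorem smoothFun_mdifferentiableAt (f : SmoothFun n M) (x : M) :
    MDifferentiableAt (𝓡 n) 𝓘(ℝ, ℝ) f x :=
  f.contMDiff.contMDiffAt.mdifferentiableAt (by simp)

/-- The derivative of a function read in a chart. -/
theorem fderiv_comp_extChartAt_symm {g : M → ℝ} {x : M} {y : EuclideanSpace ℝ (Fin n)}
    (hy : y ∈ (extChartAt (𝓡 n) x).target)
    (hg : MDifferentiableAt (𝓡 n) 𝓘(ℝ, ℝ) g ((extChartAt (𝓡 n) x).symm y))
    (v : EuclideanSpace ℝ (Fin n)) :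
    fderiv ℝ (g ∘ (extChartAt (𝓡 n) x).symm) y v =
      mvfderiv (𝓡 n) g ((extChartAt (𝓡 n) x).symm y)
        (mfderiv 𝓘(ℝ, EuclideanSpace ℝ (Fin n)) (𝓡 n) (extChartAt (𝓡 n) x).symm y v) := by
  have : IsManifold (𝓡 n) 1 M := IsManifold.of_le (n := ∞) (by simp)
  have h : MDifferentiableAt 𝓘(ℝ, EuclideanSpace ℝ (Fin n)) (𝓡 n) (extChartAt (𝓡 n) x).symm y := by
    have := mdifferentiableWithinAt_extChartAt_symm (I := 𝓡 n) hy
    rwa [ModelWithCorners.range_eq_univ, mdifferentiableWithinAt_univ] at this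
  have h1 := mvfderiv_comp_apply (I' := 𝓘(ℝ, EuclideanSpace ℝ (Fin n))) y hg h v
  rw [← h1]
  simp only [mvfderiv, mfderiv_eq_fderiv]
  rfl

/-- The pullback of V applies the inverse of the derivative of the inverse chart, and the chain rule
applies that derivative itself; the two cancel. -/
theorem fderiv_comp_extChartAt_symm_mpullback {g : M → ℝ} {x : M} {y : EuclideanSpace ℝ (Fin n)}
    (hy : y ∈ (extChartAt (𝓡 n) x).target)
    (hg : MDifferentiableAt (𝓡 n) 𝓘(ℝ, ℝ) g ((extChartAt (𝓡 n) x).symm y))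
    (V : ∀ y : M, TangentSpace (𝓡 n) y) :
    fderiv ℝ (g ∘ (extChartAt (𝓡 n) x).symm) y
        (VectorField.mpullback 𝓘(ℝ, EuclideanSpace ℝ (Fin n)) (𝓡 n) (extChartAt (𝓡 n) x).symm V y) =
      mvfderiv (𝓡 n) g ((extChartAt (𝓡 n) x).symm y) (V ((extChartAt (𝓡 n) x).symm y)) := by
  have : IsManifold (𝓡 n) 1 M := IsManifold.of_le (n := ∞) (by simp)
  refine (fderiv_comp_extChartAt_symm hy hg _).trans ?_
  rw [VectorField.mpullback_apply]
  refine congrArg _ ?_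
  have h := isInvertible_mfderivWithin_extChartAt_symm (I := 𝓡 n) hy
  simp only [ModelWithCorners.range_eq_univ, mfderivWithin_univ] at h
  exact h.self_apply_inverse _

/-- The Lie bracket of vector fields acts on functions as the commutator of derivations. -/
theorem mvfderiv_mlieBracket (f : SmoothFun n M) (V W : VecField n M) (x : M) :
    mvfderiv (𝓡 n) f x (VectorField.mlieBracket (𝓡 n) (fun y => V y) (fun y => W y) x) =
      mvfderiv (𝓡 n) (fun y => mvfderiv (𝓡 n) f y (W y)) x (V x) -
        mvfderiv (𝓡 n) (fun y => mvfderiv (𝓡 n) f y (V y)) x (W x) := by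
  have : IsManifold (𝓡 n) 1 M := IsManifold.of_le (n := ∞) (by simp)
  set φ := extChartAt (𝓡 n) x
  let V' := VectorField.mpullback 𝓘(ℝ, EuclideanSpace ℝ (Fin n)) (𝓡 n) φ.symm (fun y => V y)
  let W' := VectorField.mpullback 𝓘(ℝ, EuclideanSpace ℝ (Fin n)) (𝓡 n) φ.symm (fun y => W y)
  have hx : φ x ∈ φ.target := mem_extChartAt_target x
  have hinv : φ.symm (φ x) = x := extChartAt_to_inv x
  have htarget : φ.target ∈ nhds (φ x) := extChartAt_target_mem_nhds x
  have hf : ContDiffAt ℝ ∞ (f ∘ φ.symm) (φ x) := by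
    refine ContMDiffAt.contDiffAt ?_
    refine ContMDiffAt.comp (φ x) (f.contMDiff _) ?_
    have := contMDiffWithinAt_extChartAt_symm_range_self (I := 𝓡 n) (n := ∞) x
    rwa [ModelWithCorners.range_eq_univ, contMDiffWithinAt_univ] at this
  have hdiff (U : VecField n M) : DifferentiableAt ℝ
      (VectorField.mpullback 𝓘(ℝ, EuclideanSpace ℝ (Fin n)) (𝓡 n) φ.symm (fun y => U y)) (φ x) := by
    have h := VectorField.contMDiffWithinAt_mpullbackWithin_extChartAt_symm (I := 𝓡 n) (m := 1)
      (n := ∞) (s := Set.univ) (x := x) (V := fun y => U y)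
      ((U.contMDiff x).of_le (by simp)).contMDiffWithinAt
      uniqueMDiffOn_univ (Set.mem_univ x) (by rw [one_add_one_eq_two]; exact two_le_infty)
    simp only [ModelWithCorners.range_eq_univ, VectorField.mpullbackWithin_univ] at h
    have h2 := contMDiffWithinAt_vectorSpace_iff_contDiffWithinAt.1 h
    refine (h2.contDiffAt ?_).differentiableAt one_ne_zero
    rwa [Set.preimage_univ, Set.inter_univ]
  have hg (U : VecField n M) (z : M) : MDifferentiableAt (𝓡 n) 𝓘(ℝ, ℝ)
      (fun y => mvfderiv (𝓡 n) f y (U y)) z :=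
    smoothFun_mdifferentiableAt ((dForm f).eval U) z
  have hsecond (U U' : VecField n M) :
      fderiv ℝ (fun y => fderiv ℝ (f ∘ φ.symm) y
          (VectorField.mpullback 𝓘(ℝ, EuclideanSpace ℝ (Fin n)) (𝓡 n) φ.symm (fun y => U y) y)) (φ x)
          (VectorField.mpullback 𝓘(ℝ, EuclideanSpace ℝ (Fin n)) (𝓡 n) φ.symm
            (fun y => U' y) (φ x)) =
        mvfderiv (𝓡 n) (fun y => mvfderiv (𝓡 n) f y (U y)) x (U' x) := by
    -- The two functions agree only on the chart target; that is a neighbourhood of `φ x`, which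
    -- suffices for differentiating once more.
    have h1 : (fun y => fderiv ℝ (f ∘ φ.symm) y
        (VectorField.mpullback 𝓘(ℝ, EuclideanSpace ℝ (Fin n)) (𝓡 n) φ.symm (fun y => U y) y))
        =ᶠ[nhds (φ x)] (fun y => mvfderiv (𝓡 n) f y (U y)) ∘ φ.symm := by
      filter_upwards [htarget] with y hy
      exact fderiv_comp_extChartAt_symm_mpullback hy (smoothFun_mdifferentiableAt f _) _
    rw [h1.fderiv_eq]
    have h2 := fderiv_comp_extChartAt_symm_mpullback hx (hg U _) (fun y => U' y)
    rw [h2]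
    change mvfderiv (𝓡 n) _ (φ.symm (φ x)) (U' (φ.symm (φ x))) = _
    rw [hinv]
  have hbr : VectorField.mlieBracket (𝓡 n) (fun y => V y) (fun y => W y) x =
      (mfderiv (𝓡 n) 𝓘(ℝ, EuclideanSpace ℝ (Fin n)) φ x).inverse
        (VectorField.lieBracket ℝ V' W' (φ x)) := by
    rw [← VectorField.mlieBracketWithin_univ, VectorField.mlieBracketWithin_apply]
    simp only [ModelWithCorners.range_eq_univ, VectorField.mpullbackWithin_univ, Set.preimage_univ,
      Set.inter_univ]
    exact congrArg (fun u => (mfderiv (𝓡 n) 𝓘(ℝ, EuclideanSpace ℝ (Fin n)) φ x).inverse (u (φ x)))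
      (VectorField.lieBracketWithin_univ (𝕜 := ℝ) (V := V') (W := W'))
  have hmain : mvfderiv (𝓡 n) f x
      (VectorField.mlieBracket (𝓡 n) (fun y => V y) (fun y => W y) x) =
      fderiv ℝ (f ∘ φ.symm) (φ x) (VectorField.lieBracket ℝ V' W' (φ x)) := by
    have h1 : mvfderiv (𝓡 n) ((f ∘ φ.symm) ∘ φ) x =
        mvfderiv (𝓡 n) f x := by
      have : (f ∘ φ.symm) ∘ φ =ᶠ[nhds x] f := by
        filter_upwards [extChartAt_source_mem_nhds (I := 𝓡 n) x] with y hy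
        simp only [Function.comp_apply]
        rw [φ.left_inv hy]
      ext v
      simp only [mvfderiv, this.mfderiv_eq]
      rfl
    rw [← h1, mvfderiv_comp_apply (I := 𝓘(ℝ, EuclideanSpace ℝ (Fin n))) x
      ((hf.differentiableAt (by simp)).mdifferentiableAt)
      (mdifferentiableAt_extChartAt (mem_chart_source _ x)), hbr]
    have h2 := (isInvertible_mfderiv_extChartAt (I := 𝓡 n) (mem_extChartAt_source x)).self_apply_inverse
      (VectorField.lieBracket ℝ V' W' (φ x))
    rw [h2]
    simp only [mvfderiv, mfderiv_eq_fderiv]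
    rfl
  -- In the chart the identity is the symmetry of the second derivative of `f ∘ φ.symm`, which needs
  -- two orders of differentiability.
  rw [hmain, VectorField.fderiv_apply_lieBracket (n := ∞) hf (by simpa using two_le_infty)
    (hdiff W) (hdiff V), hsecond W V, hsecond V W]

end Geometry

/-! ### Calculus of one-forms, of ρ and ρ*, and the Leibniz rules of the Courant bracket -/

section Geometry

variable {n : ℕ} {M : Type*} [TopologicalSpace M] [ChartedSpace (EuclideanSpace ℝ (Fin n)) M]
  [IsManifold (𝓡 n) ∞ M]

theorem dForm_add (f g : SmoothFun n M) : dForm (f + g) = dForm f + dForm g := by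
  ext x : 1
  exact mvfderiv_add (smoothFun_mdifferentiableAt f x) (smoothFun_mdifferentiableAt g x)

theorem dForm_mul (f g : SmoothFun n M) : dForm (f * g) = f • dForm g + g • dForm f := by
  ext x : 1
  exact mvfderiv_mul (smoothFun_mdifferentiableAt f x) (smoothFun_mdifferentiableAt g x)

theorem dForm_const_smul (c : ℝ) (f : SmoothFun n M) : dForm (c • f) = c • dForm f := by
  ext x : 1
  have h : mvfderiv (𝓡 n) (fun y => c • f y) x =
      c • mvfderiv (𝓡 n) f x + (mvfderiv (𝓡 n) (fun _ : M => c) x).smulRight (f x) :=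
    mvfderiv_smul mdifferentiableAt_const (smoothFun_mdifferentiableAt f x)
  rw [mvfderiv_const] at h
  refine h.trans ?_
  rw [show (0 : TangentSpace (𝓡 n) x →L[ℝ] ℝ).smulRight (f x) = 0 from
    ContinuousLinearMap.ext fun v => zero_smul ℝ (f x), add_zero]
  rfl

instance OneForm.instDistribSMulReal : DistribSMul ℝ (OneForm n M) :=
  (inferInstance : Module ℝ (OneForm n M)).toDistribMulAction.toDistribSMul

instance OneForm.instDistribSMulSmoothFun : DistribSMul (SmoothFun n M) (OneForm n M) :=
  (Sec.instModuleSmoothFun : Module (SmoothFun n M) (OneForm n M)).toDistribMulAction.toDistribSMul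

namespace OneForm

theorem eval_apply (α : OneForm n M) (X : VecField n M) (x : M) : α.eval X x = α x (X x) := rfl

theorem add_eval (α β : OneForm n M) (X : VecField n M) :
    (α + β).eval X = α.eval X + β.eval X := rfl

theorem smul_eval (f : SmoothFun n M) (α : OneForm n M) (X : VecField n M) :
    (f • α).eval X = f * α.eval X := rfl

theorem const_smul_eval (c : ℝ) (α : OneForm n M) (X : VecField n M) :
    (c • α).eval X = c • α.eval X := rfl

theorem eval_add (α : OneForm n M) (X Y : VecField n M) :
    α.eval (X + Y) = α.eval X + α.eval Y := by
  ext x; exact map_add (α x) (X x) (Y x)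

theorem eval_smul (α : OneForm n M) (f : SmoothFun n M) (X : VecField n M) :
    α.eval (f • X) = f * α.eval X := by
  ext x; exact map_smul (α x) (f x) (X x)

/-- One-forms are determined by their values on vector fields. -/
theorem ext_eval [T2Space M] {α β : OneForm n M} (h : ∀ X, α.eval X = β.eval X) : α = β := by
  ext x v
  obtain ⟨X, rfl⟩ := exists_sec_apply_eq (n := n) (F := EuclideanSpace ℝ (Fin n)) x v
  exact DFunLike.congr_fun (h X) x

end OneForm

theorem iotaD_eval_apply (X Y : VecField n M) (α : OneForm n M) (x : M) :
    (iotaD X α).eval Y x = (dForm (α.eval Y)).eval X x - (dForm (α.eval X)).eval Y x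
      - α x (VectorField.mlieBracket (𝓡 n) (fun y => X y) (fun y => Y y) x) :=
  iotaD_apply X Y α x

variable [T2Space M]

/-- This is d(df) = 0: the bracket acts on f as the commutator of the two derivations. -/
theorem iotaD_dForm (X : VecField n M) (f : SmoothFun n M) : iotaD X (dForm f) = 0 := by
  refine OneForm.ext_eval fun Y => ?_
  ext x
  rw [iotaD_eval_apply]
  have h := mvfderiv_mlieBracket f X Y x
  change _ - _ - mvfderiv (𝓡 n) f x _ = 0
  rw [h]
  exact sub_self _

theorem iotaD_add_right (X : VecField n M) (α β : OneForm n M) :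
    iotaD X (α + β) = iotaD X α + iotaD X β := by
  refine OneForm.ext_eval fun Y => ?_
  ext x
  rw [OneForm.add_eval, ContMDiffMap.coe_add, Pi.add_apply]
  simp only [iotaD_eval_apply, OneForm.add_eval, dForm_add, ContMDiffMap.coe_add, Pi.add_apply,
    ContMDiffSection.coe_add, _root_.add_apply]
  ring

/-- From d(fα) = df ∧ α + f dα. The last term keeps `iotaD X` from being a derivation over X; adding
d(α(X)), as in `lieForm`, removes it. -/
theorem iotaD_smul_right (X : VecField n M) (f : SmoothFun n M) (α : OneForm n M) :
    iotaD X (f • α) = f • iotaD X α + (dForm f).eval X • α - α.eval X • dForm f := by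
  refine OneForm.ext_eval fun Y => ?_
  ext x
  have h : ((f • iotaD X α + (dForm f).eval X • α - α.eval X • dForm f).eval Y) x =
    f x * (iotaD X α).eval Y x + (dForm f).eval X x * α.eval Y x
      - α.eval X x * (dForm f).eval Y x := rfl
  rw [h]
  simp only [iotaD_eval_apply, OneForm.smul_eval, dForm_mul, OneForm.add_eval,
    ContMDiffMap.coe_add, Pi.add_apply, ContMDiffMap.coe_mul, Pi.mul_apply, Sec.smul_apply,
    _root_.smul_apply, smul_eq_mul]
  ring

theorem iotaD_const_smul_right (X : VecField n M) (c : ℝ) (α : OneForm n M) :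
    iotaD X (c • α) = c • iotaD X α := by
  refine OneForm.ext_eval fun Y => ?_
  ext x
  have h : ((c • iotaD X α).eval Y) x = c * (iotaD X α).eval Y x := rfl
  have h' (Z Z' : VecField n M) : (c • (dForm (α.eval Z)).eval Z') x =
    c * (dForm (α.eval Z)).eval Z' x := rfl
  rw [h]
  simp only [iotaD_eval_apply, OneForm.const_smul_eval, dForm_const_smul, h',
    ContMDiffSection.coe_smul, Pi.smul_apply, _root_.smul_apply, smul_eq_mul]
  ring

theorem iotaD_add_left (X X' : VecField n M) (α : OneForm n M) :
    iotaD (X + X') α = iotaD X α + iotaD X' α := by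
  refine OneForm.ext_eval fun Y => ?_
  ext x
  have hb := VectorField.mlieBracket_add_left (I := 𝓡 n) (W := fun y => Y y)
    (X.mdifferentiableAt (x := x)) (X'.mdifferentiableAt (x := x))
  have h2 : VectorField.mlieBracket (𝓡 n) (fun y => (X + X') y) (fun y => Y y) x = _ := hb
  rw [OneForm.add_eval, ContMDiffMap.coe_add, Pi.add_apply]
  simp only [iotaD_eval_apply, OneForm.add_eval, dForm_add, ContMDiffMap.coe_add, Pi.add_apply,
    OneForm.eval_add, h2, map_add]
  ring

/-- The term Y(f) α(X) from differentiating α(fX) cancels against the one from [fX, Y] = f[X, Y] -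
Y(f)X. Hence the i_{ρ(e)}dα terms of the differential are of order 0 in e before the cochain is
applied. -/
theorem iotaD_smul_left (f : SmoothFun n M) (X : VecField n M) (α : OneForm n M) :
    iotaD (f • X) α = f • iotaD X α := by
  refine OneForm.ext_eval fun Y => ?_
  ext x
  have hb := VectorField.mlieBracket_smul_left (I := 𝓡 n) (W := fun y => Y y)
    (smoothFun_mdifferentiableAt f x) (X.mdifferentiableAt (x := x))
  have h2 : VectorField.mlieBracket (𝓡 n) (fun y => (f • X) y) (fun y => Y y) x = _ := hb
  have h : ((f • iotaD X α).eval Y) x = f x * (iotaD X α).eval Y x := rfl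
  have h3 : mvfderiv (𝓡 n) f x (Y x) = (dForm f).eval Y x := rfl
  rw [h]
  simp only [iotaD_eval_apply, OneForm.add_eval, dForm_mul, ContMDiffMap.coe_add, Pi.add_apply,
    OneForm.eval_smul, OneForm.smul_eval, h2, map_add, map_neg, map_smul, ContMDiffMap.coe_mul,
    Pi.mul_apply, smul_eq_mul, neg_smul, h3, OneForm.eval_apply α X]
  ring

theorem iotaD_const_smul_left (c : ℝ) (X : VecField n M) (α : OneForm n M) :
    iotaD (c • X) α = c • iotaD X α := by
  have h := iotaD_smul_left (ContMDiffMap.const c : SmoothFun n M) X α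
  exact h

/-- The Lie derivative `L_X α = i_X dα + d(α(X))` of a one-form. -/
def lieForm (X : VecField n M) (α : OneForm n M) : OneForm n M := iotaD X α + dForm (α.eval X)

theorem lieForm_dForm (X : VecField n M) (f : SmoothFun n M) :
    lieForm X (dForm f) = dForm ((dForm f).eval X) := by
  rw [lieForm, iotaD_dForm, zero_add]

theorem lieForm_add_right (X : VecField n M) (α β : OneForm n M) :
    lieForm X (α + β) = lieForm X α + lieForm X β := by
  simp only [lieForm, iotaD_add_right, OneForm.add_eval, dForm_add]
  abel

theorem lieForm_const_smul_right (X : VecField n M) (c : ℝ) (α : OneForm n M) :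
    lieForm X (c • α) = c • lieForm X α := by
  simp only [lieForm, iotaD_const_smul_right, OneForm.const_smul_eval, dForm_const_smul, smul_add]

/-- The two terms α(X) df cancel. This is the derivation property that makes commutators with
`lieForm X` order-preserving. -/
theorem lieForm_smul_right (X : VecField n M) (f : SmoothFun n M) (α : OneForm n M) :
    lieForm X (f • α) = f • lieForm X α + (dForm f).eval X • α := by
  simp only [lieForm, iotaD_smul_right, OneForm.smul_eval, dForm_mul, smul_add]
  abel

namespace AnchoredMetricBundle

variable {F : Type*} [NormedAddCommGroup F] [NormedSpace ℝ F]
  {E : M → Type*} [∀ x, AddCommGroup (E x)] [∀ x, Module ℝ (E x)] [∀ x, TopologicalSpace (E x)]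
  [TopologicalSpace (TotalSpace F E)] [FiberBundle F E] [VectorBundle ℝ F E]
  (𝒜 : AnchoredMetricBundle n M F E)

section

omit [T2Space M]

theorem rho_add (e e' : Sec n F E) : 𝒜.rho (e + e') = 𝒜.rho e + 𝒜.rho e' := by
  ext x : 1; exact map_add (𝒜.anchor x) (e x) (e' x)

theorem rho_smul (f : SmoothFun n M) (e : Sec n F E) : 𝒜.rho (f • e) = f • 𝒜.rho e := by
  ext x : 1; exact map_smul (𝒜.anchor x) (f x) (e x)

theorem rho_const_smul (c : ℝ) (e : Sec n F E) : 𝒜.rho (c • e) = c • 𝒜.rho e := by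
  ext x : 1; exact map_smul (𝒜.anchor x) c (e x)

theorem inner_comm (e e' : Sec n F E) : 𝒜.inner e e' = 𝒜.inner e' e := by
  ext x; exact 𝒜.metric_symm x (e x) (e' x)

theorem inner_add_left (e e' e'' : Sec n F E) :
    𝒜.inner (e + e') e'' = 𝒜.inner e e'' + 𝒜.inner e' e'' := by
  ext x
  exact DFunLike.congr_fun (map_add (𝒜.metric x) (e x) (e' x)) (e'' x)

theorem inner_smul_left (f : SmoothFun n M) (e e' : Sec n F E) :
    𝒜.inner (f • e) e' = f * 𝒜.inner e e' := by
  ext x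
  exact DFunLike.congr_fun (map_smul (𝒜.metric x) (f x) (e x)) (e' x)

theorem deriv_mul (e : Sec n F E) (f g : SmoothFun n M) :
    𝒜.deriv e (f * g) = f * 𝒜.deriv e g + g * 𝒜.deriv e f := by
  simp only [deriv, dForm_mul, OneForm.add_eval, OneForm.smul_eval]

end

/-- Sections of `E` are determined by their inner products with sections. -/
theorem ext_inner [ContMDiffVectorBundle ∞ F E (𝓡 n)] {s t : Sec n F E}
    (h : ∀ e, 𝒜.inner s e = 𝒜.inner t e) : s = t := by
  ext x
  refine sub_eq_zero.1 (𝒜.metric_nondegenerate x _ fun w => ?_)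
  obtain ⟨e, rfl⟩ := exists_sec_apply_eq (n := n) (F := F) x w
  have := DFunLike.congr_fun (h e) x
  rw [map_sub]
  exact sub_eq_zero.2 this

variable [FiniteDimensional ℝ F] [ContMDiffVectorBundle ∞ F E (𝓡 n)]

omit [T2Space M] in
theorem inner_rhoStar (α : OneForm n M) (e : Sec n F E) :
    𝒜.inner (𝒜.rhoStar α) e = α.eval (𝒜.rho e) := by
  ext x; exact 𝒜.metric_rhoStar α x (e x)

theorem rhoStar_add (α β : OneForm n M) :
    𝒜.rhoStar (α + β) = 𝒜.rhoStar α + 𝒜.rhoStar β :=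
  𝒜.ext_inner fun e => by simp only [inner_add_left, inner_rhoStar, OneForm.add_eval]

theorem rhoStar_smul (f : SmoothFun n M) (α : OneForm n M) :
    𝒜.rhoStar (f • α) = f • 𝒜.rhoStar α :=
  𝒜.ext_inner fun e => by simp only [inner_smul_left, inner_rhoStar, OneForm.smul_eval]

theorem rhoStar_const_smul (c : ℝ) (α : OneForm n M) :
    𝒜.rhoStar (c • α) = c • 𝒜.rhoStar α :=
  𝒜.rhoStar_smul (ContMDiffMap.const c) α

theorem dE_mul (f g : SmoothFun n M) : 𝒜.dE (f * g) = f • 𝒜.dE g + g • 𝒜.dE f := by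
  simp only [dE, dForm_mul, rhoStar_add, rhoStar_smul]

end AnchoredMetricBundle

namespace CourantAlgebroid

variable {F : Type*} [NormedAddCommGroup F] [NormedSpace ℝ F] [FiniteDimensional ℝ F]
  {E : M → Type*} [∀ x, AddCommGroup (E x)] [∀ x, Module ℝ (E x)] [∀ x, TopologicalSpace (E x)]
  [TopologicalSpace (TotalSpace F E)] [FiberBundle F E] [VectorBundle ℝ F E]
  [ContMDiffVectorBundle ∞ F E (𝓡 n)] (𝒜 : CourantAlgebroid n M F E)

/-- The Leibniz rule for the bracket in its second argument. -/
theorem bracket_smul_right (e : Sec n F E) (f : SmoothFun n M) (e' : Sec n F E) :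
    𝒜.bracket e (f • e') = f • 𝒜.bracket e e' + 𝒜.deriv e f • e' := by
  refine 𝒜.ext_inner fun s => ?_
  -- Both sides are paired with s. Invariance of the metric is written for f e' and for e', and the
  -- product rule for ρ(e)(f⟨e', s⟩) compares the two.
  have h1 := 𝒜.deriv_inner e (f • e') s
  have h2 := 𝒜.deriv_inner e e' s
  rw [𝒜.inner_smul_left, 𝒜.deriv_mul, 𝒜.inner_smul_left, h2] at h1
  rw [𝒜.inner_add_left, 𝒜.inner_smul_left, 𝒜.inner_smul_left]
  linear_combination -h1

/-- The Leibniz rule for the bracket in its first argument. -/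
theorem bracket_smul_left (f : SmoothFun n M) (e e' : Sec n F E) :
    𝒜.bracket (f • e) e' =
      f • 𝒜.bracket e e' - 𝒜.deriv e' f • e + 𝒜.inner e e' • 𝒜.dE f := by
  -- The symmetric part of the bracket reduces the claim to the Leibniz rule in the second argument;
  -- the term in d_E f comes from d_E(f⟨e, e'⟩).
  have h1 := 𝒜.bracket_add_swap (f • e) e'
  have h2 := 𝒜.bracket_add_swap e e'
  rw [bracket_smul_right, 𝒜.inner_smul_left, 𝒜.dE_mul, ← h2, smul_add] at h1
  rw [eq_sub_of_add_eq h1]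
  abel

end CourantAlgebroid

end Geometry

/-! ### Algebra of differential operators defined by their symbols -/

section DiffOp

variable {R : Type*} [CommRing R] {U V W : Type*} [AddCommGroup U] [Module R U] [AddCommGroup V]
  [Module R V] [AddCommGroup W] [Module R W]

namespace IsDiffOp

theorem zero (s : ℕ) : IsDiffOp R s (fun _ : V => (0 : W)) := by
  induction s with
  | zero => intro f v; simp
  | succ s ih => intro f; simpa using ih

theorem succ {s : ℕ} {P : V → W} (h : IsDiffOp R s P) : IsDiffOp R (s + 1) P := by
  induction s generalizing P with
  | zero =>
    intro f
    have : (fun v => P (f • v) - f • P v) = fun _ => 0 := funext (h f)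
    rw [this]
    exact zero 0
  | succ s ih => intro f; exact ih (h f)

theorem mono {s t : ℕ} (hst : s ≤ t) {P : V → W} (h : IsDiffOp R s P) : IsDiffOp R t P := by
  induction t, hst using Nat.le_induction with
  | base => exact h
  | succ t _ ih => exact ih.succ

theorem add {s : ℕ} {P Q : V → W} (hP : IsDiffOp R s P) (hQ : IsDiffOp R s Q) :
    IsDiffOp R s (fun v => P v + Q v) := by
  induction s generalizing P Q with
  | zero =>
    intro f v
    have h1 := hP f v
    have h2 := hQ f v
    rw [smul_add, add_sub_add_comm, h1, h2, add_zero]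
  | succ s ih =>
    intro f
    refine Eq.mp ?_ (ih (hP f) (hQ f))
    congr 1
    funext v
    rw [smul_add, add_sub_add_comm]

theorem neg {s : ℕ} {P : V → W} (hP : IsDiffOp R s P) : IsDiffOp R s (fun v => - P v) := by
  induction s generalizing P with
  | zero =>
    intro f v
    have h1 := hP f v
    rw [smul_neg, neg_sub_neg, ← neg_sub, h1, neg_zero]
  | succ s ih =>
    intro f
    refine Eq.mp ?_ (ih (hP f))
    congr 1
    funext v
    rw [smul_neg, neg_sub_neg, neg_sub]

theorem sub {s : ℕ} {P Q : V → W} (hP : IsDiffOp R s P) (hQ : IsDiffOp R s Q) :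
    IsDiffOp R s (fun v => P v - Q v) := by
  simpa only [sub_eq_add_neg] using hP.add hQ.neg

/-- The symbol of P ∘ Q at f is P ∘ σ_f(Q) + σ_f(P) ∘ Q, and each summand has total order one less,
so induction on s + t applies. Additivity of P is what splits the symbol. -/
theorem comp {s t : ℕ} {P : V → W} {Q : U → V} (hadd : ∀ v v', P (v + v') = P v + P v')
    (hP : IsDiffOp R s P) (hQ : IsDiffOp R t Q) : IsDiffOp R (s + t) (fun u => P (Q u)) := by
  induction hn : s + t generalizing s t P Q with
  | zero =>
    obtain ⟨rfl, rfl⟩ : s = 0 ∧ t = 0 := by omega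
    intro f u
    have h1 : Q (f • u) = f • Q u := sub_eq_zero.1 (hQ f u)
    change P (Q (f • u)) - f • P (Q u) = 0
    rw [h1]
    exact hP f (Q u)
  | succ k ih =>
    intro f
    have key : (fun u => P (Q (f • u)) - f • P (Q u)) =
        fun u => P (Q (f • u) - f • Q u) + (P (f • Q u) - f • P (Q u)) := by
      funext u
      have : P (Q (f • u)) = P (Q (f • u) - f • Q u) + P (f • Q u) := by
        rw [← hadd, sub_add_cancel]
      rw [this, add_sub_assoc]
    rw [key]
    refine add ?_ ?_
    -- An operator of order 0 has no symbol of lower order to recurse on; its symbol is zero, so the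
    -- summand vanishes.
    · cases t with
      | zero =>
        have h1 (u : U) : Q (f • u) - f • Q u = 0 := hQ f u
        simp only [h1, show P 0 = 0 by simpa using hadd 0 0]
        exact zero k
      | succ t => exact ih hadd hP (hQ f) (by omega)
    · cases s with
      | zero =>
        have h1 (u : U) : P (f • Q u) - f • P (Q u) = 0 := hP f (Q u)
        simp only [h1]
        exact zero k
      | succ s =>
        refine ih (P := fun v => P (f • v) - f • P v) ?_ (hP f) hQ (by omega)
        intro v v'
        simp only [smul_add, hadd]
        abel

/-- The commutator of a differential operator with a pair of derivations over the same derivation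
of the ring has the same order. -/
theorem lie {s : ℕ} {P : V → W} {X : V → V} {Y : W → W} (δ : R → R)
    (hX : ∀ f v, X (f • v) = f • X v + δ f • v) (hY : ∀ f w, Y (f • w) = f • Y w + δ f • w)
    (hYadd : ∀ w w', Y (w + w') = Y w + Y w') (hadd : ∀ v v', P (v + v') = P v + P v')
    (hP : IsDiffOp R s P) : IsDiffOp R s (fun v => Y (P v) - P (X v)) := by
  -- The symbol at f of Y ∘ P - P ∘ X is the same commutator formed with σ_f(P), minus σ_{δ f}(P).
  -- Both have one order less than P by induction, so the derivations cost nothing.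
  have key (P : V → W) (hadd : ∀ v v', P (v + v') = P v + P v') (f : R) (v : V) :
      Y (P (f • v)) - P (X (f • v)) - f • (Y (P v) - P (X v)) =
        (Y (P (f • v) - f • P v) - (P (f • X v) - f • P (X v))) -
          (P (δ f • v) - δ f • P v) := by
    have h1 : Y (P (f • v)) = Y (P (f • v) - f • P v) + (f • Y (P v) + δ f • P v) := by
      rw [← hY, ← hYadd, sub_add_cancel]
    rw [hX, hadd, h1, smul_sub]
    abel
  induction s generalizing P with
  | zero =>
    have hY0 : Y 0 = 0 := by simpa using hYadd 0 0
    intro f v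
    have h (f : R) (v : V) : P (f • v) - f • P v = 0 := hP f v
    rw [key P hadd, h, h, h, hY0]
    simp
  | succ s ih =>
    intro f
    simp only [key P hadd]
    refine sub (ih (P := fun v => P (f • v) - f • P v) ?_ (hP f)) (hP (δ f))
    intro v v'
    simp only [smul_add, hadd]
    abel

end IsDiffOp

variable [Module ℝ U] [Module ℝ V] [Module ℝ W]

/-- `ℝ`-linear differential operators of order at most `s`. -/
structure IsLinDiffOp (R : Type*) [CommRing R] {V W : Type*} [AddCommGroup V] [Module R V]
    [AddCommGroup W] [Module R W] [Module ℝ V] [Module ℝ W] (s : ℕ) (P : V → W) : Prop where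
  map_add : ∀ v v', P (v + v') = P v + P v'
  map_smul : ∀ (c : ℝ) v, P (c • v) = c • P v
  isDiffOp : IsDiffOp R s P

namespace IsLinDiffOp

variable {s t : ℕ} {P Q : V → W}

theorem zero (s : ℕ) : IsLinDiffOp R s (fun _ : V => (0 : W)) :=
  ⟨by simp, by simp, IsDiffOp.zero s⟩

theorem map_zero (h : IsLinDiffOp R s P) : P 0 = 0 := by
  simpa using h.map_add 0 0

theorem mono (hst : s ≤ t) (h : IsLinDiffOp R s P) : IsLinDiffOp R t P :=
  ⟨h.map_add, h.map_smul, h.isDiffOp.mono hst⟩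

theorem map_neg (h : IsLinDiffOp R s P) (v : V) : P (-v) = - P v := by
  rw [eq_neg_iff_add_eq_zero, ← h.map_add, neg_add_cancel, h.map_zero]

theorem add (hP : IsLinDiffOp R s P) (hQ : IsLinDiffOp R s Q) :
    IsLinDiffOp R s (fun v => P v + Q v) :=
  ⟨fun v v' => by simp only [hP.map_add, hQ.map_add]; abel,
    fun c v => by simp only [hP.map_smul, hQ.map_smul, smul_add], hP.isDiffOp.add hQ.isDiffOp⟩

theorem neg (hP : IsLinDiffOp R s P) : IsLinDiffOp R s (fun v => - P v) :=
  ⟨fun v v' => by simp only [hP.map_add]; abel,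
    fun c v => by simp only [hP.map_smul, smul_neg], hP.isDiffOp.neg⟩

theorem sub (hP : IsLinDiffOp R s P) (hQ : IsLinDiffOp R s Q) :
    IsLinDiffOp R s (fun v => P v - Q v) := by
  simpa only [sub_eq_add_neg] using hP.add hQ.neg

theorem sum {ι : Type*} (S : Finset ι) {P : ι → V → W} (h : ∀ i ∈ S, IsLinDiffOp R s (P i)) :
    IsLinDiffOp R s (fun v => ∑ i ∈ S, P i v) := by
  classical
  induction S using Finset.induction_on with
  | empty => simpa using zero s
  | insert a S ha ih =>
    simp only [Finset.sum_insert ha]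
    exact (h a (Finset.mem_insert_self a S)).add
      (ih fun i hi => h i (Finset.mem_insert_of_mem hi))

theorem neg_one_pow_smul (k : ℕ) (hP : IsLinDiffOp R s P) :
    IsLinDiffOp R s (fun v => (-1 : ℤ) ^ k • P v) := by
  rcases neg_one_pow_eq_or ℤ k with h | h <;> simp only [h, one_smul, neg_smul]
  exacts [hP, hP.neg]

theorem comp {Q : U → V} (hP : IsLinDiffOp R s P) (hQ : IsLinDiffOp R t Q) :
    IsLinDiffOp R (s + t) (fun u => P (Q u)) :=
  ⟨fun u u' => by rw [hQ.map_add, hP.map_add], fun c u => by rw [hQ.map_smul, hP.map_smul],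
    hP.isDiffOp.comp hP.map_add hQ.isDiffOp⟩

theorem comp_le {r : ℕ} {Q : U → V} (hP : IsLinDiffOp R s P) (hQ : IsLinDiffOp R t Q)
    (h : s + t ≤ r) : IsLinDiffOp R r (fun u => P (Q u)) :=
  (hP.comp hQ).mono h

theorem of_linear (hadd : ∀ v v', P (v + v') = P v + P v')
    (hsmul : ∀ (c : ℝ) v, P (c • v) = c • P v) (h : ∀ (f : R) v, P (f • v) = f • P v) :
    IsLinDiffOp R 0 P :=
  ⟨hadd, hsmul, fun f v => sub_eq_zero.2 (h f v)⟩

/-- Covers first-order operators whose symbol is linear over R without being multiplication by a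
function, such as the bracket in its first argument and a Dorfman connection in the section of E. -/
theorem of_symbol (σ : R → V → W) (hadd : ∀ v v', P (v + v') = P v + P v')
    (hsmul : ∀ (c : ℝ) v, P (c • v) = c • P v)
    (h : ∀ (f : R) v, P (f • v) = f • P v + σ f v)
    (hσ : ∀ (f g : R) v, σ f (g • v) = g • σ f v) : IsLinDiffOp R 1 P := by
  refine ⟨hadd, hsmul, fun f => ?_⟩
  simp only [h, add_sub_cancel_left]
  exact fun g v => sub_eq_zero.2 (hσ f g v)

theorem of_leibniz {P : V → V} (δ : R → R) (hadd : ∀ v v', P (v + v') = P v + P v')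
    (hsmul : ∀ (c : ℝ) v, P (c • v) = c • P v)
    (h : ∀ (f : R) v, P (f • v) = f • P v + δ f • v) : IsLinDiffOp R 1 P :=
  .of_symbol (fun f v => δ f • v) hadd hsmul h fun _ _ _ => smul_comm _ _ _

theorem lie (hP : IsLinDiffOp R s P) {X : V → V} {Y : W → W} (δ : R → R)
    (hX : IsLinDiffOp R 1 X) (hY : IsLinDiffOp R 1 Y)
    (hX' : ∀ f v, X (f • v) = f • X v + δ f • v) (hY' : ∀ f w, Y (f • w) = f • Y w + δ f • w) : IsLinDiffOp R s (fun v => Y (P v) - P (X v)) :=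
  -- Taken apart, the two terms only have order s + 1; this crude bound serves for linearity alone,
  -- and the order s comes from `IsDiffOp.lie`.
  have h := (hY.comp hP).mono (le_max_left _ (s + 1)) |>.sub
    ((hP.comp hX).mono (le_max_right _ _))
  ⟨h.map_add, h.map_smul, hP.isDiffOp.lie δ hX' hY' hY.map_add hP.map_add⟩

end IsLinDiffOp

end DiffOp

/-! ### Removing, prepending and permuting entries of tuples -/

section Tuples

variable {α : Type*} {k : ℕ}

theorem removeNth_succ_cons (μ : Fin (k + 1)) (a : α) (v : Fin (k + 1) → α) :
    μ.succ.removeNth (Fin.cons a v : Fin (k + 2) → α) = Fin.cons a (μ.removeNth v) := by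
  ext i
  refine Fin.cases ?_ (fun i => ?_) i <;> simp [Fin.removeNth]

theorem removeNth_zero_cons (a : α) (v : Fin k → α) :
    (0 : Fin (k + 1)).removeNth (Fin.cons a v : Fin (k + 1) → α) = v := by
  simp

/-- σ restricts to a bijection from the indices other than μ to those other than σ μ. This is what
reindexes the ρ*-part of the differential under a permutation of the one-forms. -/
theorem exists_removeNth_comp_perm (v : Fin (k + 1) → α) (σ : Equiv.Perm (Fin (k + 1)))
    (μ : Fin (k + 1)) :
    ∃ τ : Equiv.Perm (Fin k), μ.removeNth (v ∘ σ) = (σ μ).removeNth v ∘ τ := by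
  let τ : Equiv.Perm (Fin k) := (finSuccAboveEquiv μ).trans
    ((σ.subtypeEquiv (p := fun i => i ≠ μ) (q := fun i => i ≠ σ μ) (by simp)).trans
      (finSuccAboveEquiv (σ μ)).symm)
  refine ⟨τ, funext fun i => ?_⟩
  have h : (σ μ).succAbove (τ i) = σ (μ.succAbove i) :=
    congrArg Subtype.val ((finSuccAboveEquiv (σ μ)).apply_symm_apply
      (σ.subtypeEquiv (p := fun i => i ≠ μ) (q := fun i => i ≠ σ μ) (by simp)
        (finSuccAboveEquiv μ i)))
  simp [Fin.removeNth, h]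

theorem cons_comp_perm (a : α) (v : Fin k → α) (σ : Equiv.Perm (Fin k)) :
    (Fin.cons a (v ∘ σ) : Fin (k + 1) → α) =
      (Fin.cons a v : Fin (k + 1) → α) ∘ Equiv.Perm.decomposeFin.symm (0, σ) := by
  ext i
  refine Fin.cases ?_ (fun i => ?_) i <;> simp

theorem cons_cons_swap (a b : α) (v : Fin k → α) :
    (Fin.cons a (Fin.cons b v : Fin (k + 1) → α) : Fin (k + 2) → α) ∘
      Equiv.swap (0 : Fin (k + 1)).castSucc (0 : Fin (k + 1)).succ =
      Fin.cons b (Fin.cons a v : Fin (k + 1) → α) := by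
  ext i
  refine Fin.cases ?_ (fun i => Fin.cases ?_ (fun i => ?_) i) i
  · simp
  · simp
  · have h : Equiv.swap (0 : Fin (k + 1)).castSucc (0 : Fin (k + 1)).succ i.succ.succ =
      i.succ.succ := Equiv.swap_apply_of_ne_of_ne (Fin.succ_ne_zero _)
        (fun h => Fin.succ_ne_zero i (Fin.succ_injective _ h))
    simp only [Function.comp_apply, h, Fin.cons_succ]

theorem cons_comp_swap (a : α) (v : Fin (k + 2) → α) (i : Fin (k + 1)) :
    (Fin.cons a (v ∘ Equiv.swap i.castSucc i.succ) : Fin (k + 3) → α) =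
      (Fin.cons a v : Fin (k + 3) → α) ∘ Equiv.swap i.succ.castSucc i.succ.succ := by
  ext l
  refine Fin.cases ?_ (fun l => ?_) l
  · have h : Equiv.swap i.succ.castSucc i.succ.succ 0 = 0 :=
      Equiv.swap_apply_of_ne_of_ne (by rw [← Fin.succ_castSucc]; exact (Fin.succ_ne_zero _).symm)
        (Fin.succ_ne_zero _).symm
    simp only [Function.comp_apply, h, Fin.cons_zero]
  · have h : Equiv.swap i.succ.castSucc i.succ.succ l.succ =
        (Equiv.swap i.castSucc i.succ l).succ := by
      rw [← Fin.succ_castSucc]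
      exact ((Fin.succ_injective _).map_swap i.castSucc i.succ l).symm
    simp only [Function.comp_apply, h, Fin.cons_succ]

theorem exists_eq_cons (v : Fin (k + 1) → α) : ∃ a v', v = Fin.cons a v' :=
  ⟨v 0, Fin.tail v, (Fin.cons_self_tail v).symm⟩

end Tuples

open Function (update)

/-! ### The Lie derivative of a cochain and recursions in the first argument -/

section Cochains

variable {n : ℕ} {M : Type*} [TopologicalSpace M] [ChartedSpace (EuclideanSpace ℝ (Fin n)) M]
  [IsManifold (𝓡 n) ∞ M]
  {F : Type*} [NormedAddCommGroup F] [NormedSpace ℝ F] [FiniteDimensional ℝ F]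
  {E : M → Type*} [∀ x, AddCommGroup (E x)] [∀ x, Module ℝ (E x)] [∀ x, TopologicalSpace (E x)]
  [TopologicalSpace (TotalSpace F E)] [FiberBundle F E] [VectorBundle ℝ F E]
  [ContMDiffVectorBundle ∞ F E (𝓡 n)]
  {W : Type*} [AddCommGroup W]

/-- The Lie derivative of a cochain along a section `e`, when sections act on the values by `D`. -/
def lieD (𝒜 : CourantAlgebroid n M F E) (D : Sec n F E → W → W) (e : Sec n F E)
    (H : Cochain n F E W) : Cochain n F E W :=
  fun j k es αs => D e (H j k es αs) -
    ∑ μ : Fin k, H j k es (update αs μ (lieForm (𝒜.rho e) (αs μ))) -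
    ∑ l : Fin j, H j k (update es l (𝒜.bracket e (es l))) αs

variable (𝒜 : CourantAlgebroid n M F E) (D : Sec n F E → W → W)

/-- The commutation rule i_{e'} L_e = L_e i_{e'} - i_{[e, e']}, with the subtracted term coming from
the bracket in the first slot. It drives the inductions on the number of sections. -/
theorem lieD_cons (e e' : Sec n F E) (H : Cochain n F E W) (j k : ℕ) (es : Fin j → Sec n F E)
    (αs : Fin k → OneForm n M) :
    lieD 𝒜 D e H (j + 1) k (Fin.cons e' es) αs =
      lieD 𝒜 D e (iSec e' H) j k es αs - iSec (𝒜.bracket e e') H j k es αs := by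
  simp only [lieD, iSec, Fin.sum_univ_succ, Fin.cons_zero, Fin.cons_succ, Fin.update_cons_zero,
    Fin.cons_update]
  abel

theorem lieD_form_cons (e : Sec n F E) (α : OneForm n M) (H : Cochain n F E W) (j k : ℕ)
    (es : Fin j → Sec n F E) (αs : Fin k → OneForm n M) :
    lieD 𝒜 D e H j (k + 1) es (Fin.cons α αs) =
      lieD 𝒜 D e (iForm α H) j k es αs - iForm (lieForm (𝒜.rho e) α) H j k es αs := by
  simp only [lieD, iForm, Fin.sum_univ_succ, Fin.cons_zero, Fin.cons_succ, Fin.update_cons_zero,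
    Fin.cons_update]
  abel

/-- The term i = 0 is split off; in the others e stays in first place and the index shift flips the
sign, giving the contracted cochain. -/
theorem diffPartDeriv_cons (e : Sec n F E) (H : Cochain n F E W) (j k : ℕ)
    (es : Fin j → Sec n F E) (αs : Fin k → OneForm n M) :
    diffPartDeriv 𝒜 D H (j + 1) k (Fin.cons e es) αs =
      D e (H j k es αs) - ∑ μ : Fin k, H j k es (update αs μ (iotaD (𝒜.rho e) (αs μ))) -
        diffPartDeriv 𝒜 D (iSec e H) j k es αs := by
  cases j with
  | zero => simp [diffPartDeriv]
  | succ j =>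
    simp only [diffPartDeriv, iSec]
    rw [Fin.sum_univ_succ]
    simp only [Fin.cons_zero, Fin.cons_succ, removeNth_zero_cons, removeNth_succ_cons,
      Fin.val_zero, Fin.val_succ, pow_zero, one_smul, pow_succ, mul_neg, mul_one, neg_smul,
      Finset.sum_neg_distrib]
    abel

theorem diffPartBracket_cons (e : Sec n F E) (H : Cochain n F E W) (j k : ℕ)
    (es : Fin j → Sec n F E) (αs : Fin k → OneForm n M) :
    diffPartBracket 𝒜 H (j + 1) k (Fin.cons e es) αs =
      - ∑ l : Fin j, H j k (update es l (𝒜.bracket e (es l))) αs -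
        diffPartBracket 𝒜 (iSec e H) j k es αs := by
  cases j with
  | zero => simp [diffPartBracket]
  | succ j =>
    simp only [diffPartBracket, iSec]
    rw [Fin.sum_univ_succ]
    simp only [Fin.sum_Ioi_zero, Fin.sum_Ioi_succ, Fin.cons_zero, Fin.cons_succ,
      ← Fin.cons_update, removeNth_zero_cons, removeNth_succ_cons,
      Fin.val_zero, Fin.val_succ, zero_add, pow_one, neg_smul, one_smul]
    simp only [pow_succ, mul_neg, mul_one, neg_smul, neg_neg, Finset.sum_neg_distrib,
      sub_neg_eq_add]

theorem diffPartForm_form_cons (α : OneForm n M) (H : Cochain n F E W) (j k : ℕ)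
    (es : Fin j → Sec n F E) (αs : Fin k → OneForm n M) :
    diffPartForm 𝒜 H j (k + 1) es (Fin.cons α αs) =
      H (j + 1) k (Fin.cons (𝒜.rhoStar α) es) αs + diffPartForm 𝒜 (iForm α H) j k es αs := by
  cases k with
  | zero => simp [diffPartForm]
  | succ k =>
    simp only [diffPartForm, iForm]
    rw [Fin.sum_univ_succ]
    simp only [Fin.cons_zero, Fin.cons_succ, removeNth_zero_cons, removeNth_succ_cons]

theorem cochainDiff_zero_left (H : Cochain n F E W) (k : ℕ) (es : Fin 0 → Sec n F E)
    (αs : Fin k → OneForm n M) :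
    cochainDiff 𝒜 D H 0 k es αs = diffPartForm 𝒜 H 0 k es αs := by
  simp [cochainDiff, diffPartDeriv, diffPartBracket]

end Cochains

/-! ### Cochains with order bounds, the swap relation, and contractions -/

section Cochains

variable {n : ℕ} {M : Type*} [TopologicalSpace M] [ChartedSpace (EuclideanSpace ℝ (Fin n)) M]
  [IsManifold (𝓡 n) ∞ M]
  {F : Type*} [NormedAddCommGroup F] [NormedSpace ℝ F]
  {E : M → Type*} [∀ x, AddCommGroup (E x)] [∀ x, Module ℝ (E x)] [∀ x, TopologicalSpace (E x)]
  [TopologicalSpace (TotalSpace F E)] [FiberBundle F E] [VectorBundle ℝ F E]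
  {W : Type*} [AddCommGroup W] [Module ℝ W] [Module (SmoothFun n M) W]

/-- The multilinearity, symmetry and order conditions on a cochain, without homogeneity: the
components are `ℝ`-linear differential operators of order at most `b` in the last section and at
most `a` in each other argument. -/
structure IsOrderCochain (𝒜 : AnchoredMetricBundle n M F E) (a b : ℕ) (H : Cochain n F E W) :
    Prop where
  arg : ∀ j k es αs (i : Fin j), IsLinDiffOp (SmoothFun n M) (if (i : ℕ) + 1 = j then b else a)
    (fun e : Sec n F E => H j k (update es i e) αs)
  form : ∀ j k es αs (i : Fin k), IsLinDiffOp (SmoothFun n M) a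
    (fun α : OneForm n M => H j k es (update αs i α))
  symm : ∀ j k es αs (σ : Equiv.Perm (Fin k)), H j k es (αs ∘ σ) = H j k es αs
  swap : ∀ j k (es : Fin (j + 2) → Sec n F E) αs (i : Fin (j + 1)),
    H (j + 2) k es αs + H (j + 2) k (es ∘ Equiv.swap i.castSucc i.succ) αs =
      - H j (k + 1) (i.removeNth (i.castSucc.removeNth es))
          (Fin.cons (dForm (𝒜.inner (es i.castSucc) (es i.succ))) αs)

/-- The conditions on an action of sections on the values of cochains: it is by derivations and
is a first order differential operator in the section. -/
structure IsSecAction (𝒜 : AnchoredMetricBundle n M F E) (D : Sec n F E → W → W) : Prop where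
  left : ∀ w, IsLinDiffOp (SmoothFun n M) 1 (fun e => D e w)
  right : ∀ e, IsLinDiffOp (SmoothFun n M) 1 (D e)
  leibniz : ∀ e (f : SmoothFun n M) w, D e (f • w) = f • D e w + 𝒜.deriv e f • w

namespace IsOrderCochain

variable {𝒜 : AnchoredMetricBundle n M F E} {a b : ℕ} {H : Cochain n F E W}

theorem arg_cons (h : IsOrderCochain 𝒜 a b H) (j k : ℕ) (es : Fin j → Sec n F E)
    (αs : Fin k → OneForm n M) :
    IsLinDiffOp (SmoothFun n M) (if j = 0 then b else a)
      (fun e : Sec n F E => H (j + 1) k (Fin.cons e es) αs) := by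
  have := h.arg (j + 1) k (Fin.cons 0 es) αs 0
  have hj : ((0 : Fin (j + 1)) : ℕ) + 1 = j + 1 ↔ j = 0 := by simp
  simpa only [Fin.update_cons_zero, hj] using this

theorem form_cons (h : IsOrderCochain 𝒜 a b H) (j k : ℕ) (es : Fin j → Sec n F E)
    (αs : Fin k → OneForm n M) :
    IsLinDiffOp (SmoothFun n M) a
      (fun α : OneForm n M => H j (k + 1) es (Fin.cons α αs)) := by
  have := h.form j (k + 1) es (Fin.cons 0 αs) 0
  simpa only [Fin.update_cons_zero] using this

theorem form_cons_zero (h : IsOrderCochain 𝒜 a b H) (j k : ℕ) (es : Fin j → Sec n F E)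
    (αs : Fin k → OneForm n M) : H j (k + 1) es (Fin.cons 0 αs) = 0 :=
  (h.form_cons j k es αs).map_zero

theorem arg_update (h : IsOrderCochain 𝒜 a a H) (j k : ℕ) (es : Fin j → Sec n F E)
    (αs : Fin k → OneForm n M) (i : Fin j) : IsLinDiffOp (SmoothFun n M) a
      (fun e : Sec n F E => H j k (update es i e) αs) := by
  simpa only [ite_self] using h.arg j k es αs i

theorem arg_cons' (h : IsOrderCochain 𝒜 a a H) (j k : ℕ) (es : Fin j → Sec n F E)
    (αs : Fin k → OneForm n M) :
    IsLinDiffOp (SmoothFun n M) a (fun e : Sec n F E => H (j + 1) k (Fin.cons e es) αs) := by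
  simpa only [ite_self] using h.arg_cons j k es αs

theorem swap_zero (h : IsOrderCochain 𝒜 a b H) (j k : ℕ) (e e' : Sec n F E)
    (es : Fin j → Sec n F E) (αs : Fin k → OneForm n M) :
    H (j + 2) k (Fin.cons e (Fin.cons e' es : Fin (j + 1) → Sec n F E)) αs +
        H (j + 2) k (Fin.cons e' (Fin.cons e es : Fin (j + 1) → Sec n F E)) αs =
      - H j (k + 1) es (Fin.cons (dForm (𝒜.inner e e')) αs) := by
  have := h.swap j k (Fin.cons e (Fin.cons e' es : Fin (j + 1) → Sec n F E)) αs 0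
  rw [cons_cons_swap] at this
  simpa using this

theorem iSec_iSec (h : IsOrderCochain 𝒜 a b H) (e e' : Sec n F E) :
    iSec e (iSec e' H) + iSec e' (iSec e H) = - iFun (𝒜.inner e e') H := by
  funext j k es αs
  change H (j + 2) k _ αs + H (j + 2) k _ αs = - H j (k + 1) es _
  rw [h.swap_zero, 𝒜.inner_comm]

theorem mono {a' b' : ℕ} (ha : a ≤ a') (hb : b ≤ b') (h : IsOrderCochain 𝒜 a b H) :
    IsOrderCochain 𝒜 a' b' H where
  arg j k es αs i := (h.arg j k es αs i).mono (by split_ifs <;> assumption)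
  form j k es αs i := (h.form j k es αs i).mono ha
  symm := h.symm
  swap := h.swap

theorem add {H' : Cochain n F E W} (h : IsOrderCochain 𝒜 a b H) (h' : IsOrderCochain 𝒜 a b H') :
    IsOrderCochain 𝒜 a b (H + H') where
  arg j k es αs i := (h.arg j k es αs i).add (h'.arg j k es αs i)
  form j k es αs i := (h.form j k es αs i).add (h'.form j k es αs i)
  symm j k es αs σ := congrArg₂ (· + ·) (h.symm j k es αs σ) (h'.symm j k es αs σ)
  swap j k es αs i := by
    have h1 := h.swap j k es αs i
    have h2 := h'.swap j k es αs i
    simp only [Pi.add_apply]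
    rw [add_add_add_comm, h1, h2, neg_add]

end IsOrderCochain

/-- The relation between a component and its transposition of the arguments `i` and `i + 1`. -/
def SwapAt (𝒜 : AnchoredMetricBundle n M F E) (H : Cochain n F E W) (j k : ℕ)
    (es : Fin (j + 2) → Sec n F E) (αs : Fin k → OneForm n M) (i : Fin (j + 1)) : Prop :=
  H (j + 2) k es αs + H (j + 2) k (es ∘ Equiv.swap i.castSucc i.succ) αs =
    - H j (k + 1) (i.removeNth (i.castSucc.removeNth es))
      (Fin.cons (dForm (𝒜.inner (es i.castSucc) (es i.succ))) αs)

section SwapAt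

omit [Module ℝ W] [Module (SmoothFun n M) W]

variable {𝒜 : AnchoredMetricBundle n M F E} {H : Cochain n F E W}

theorem swapAt_zero_cons_iff {j k : ℕ} {e e' : Sec n F E} {es : Fin j → Sec n F E}
    {αs : Fin k → OneForm n M} :
    SwapAt 𝒜 H j k (Fin.cons e (Fin.cons e' es : Fin (j + 1) → Sec n F E)) αs 0 ↔
      H (j + 2) k (Fin.cons e (Fin.cons e' es : Fin (j + 1) → Sec n F E)) αs +
        H (j + 2) k (Fin.cons e' (Fin.cons e es : Fin (j + 1) → Sec n F E)) αs =
      - H j (k + 1) es (Fin.cons (dForm (𝒜.inner e e')) αs) := by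
  rw [SwapAt, cons_cons_swap]
  simp

/-- A transposition away from the first argument is one for the contracted cochain, so by induction
only the transposition of the first two arguments needs a computation. -/
theorem swapAt_succ_cons_iff {j k : ℕ} {e : Sec n F E} {es : Fin (j + 2) → Sec n F E}
    {αs : Fin k → OneForm n M} {i : Fin (j + 1)} :
    SwapAt 𝒜 H (j + 1) k (Fin.cons e es) αs i.succ ↔ SwapAt 𝒜 (iSec e H) j k es αs i := by
  rw [SwapAt, SwapAt, ← cons_comp_swap]
  simp only [iSec, ← Fin.succ_castSucc, Fin.cons_succ, removeNth_succ_cons]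

theorem SwapAt.sub {H' : Cochain n F E W} {j k : ℕ} {es : Fin (j + 2) → Sec n F E}
    {αs : Fin k → OneForm n M} {i : Fin (j + 1)} (h : SwapAt 𝒜 H j k es αs i)
    (h' : SwapAt 𝒜 H' j k es αs i) : SwapAt 𝒜 (H - H') j k es αs i := by
  simp only [SwapAt, Pi.sub_apply] at h h' ⊢
  rw [sub_add_sub_comm, h, h', neg_sub_neg, neg_sub]

end SwapAt

namespace IsOrderCochain

variable {𝒜 : AnchoredMetricBundle n M F E} {a b : ℕ} {H : Cochain n F E W}

theorem iSec (h : IsOrderCochain 𝒜 a b H) (e : Sec n F E) : IsOrderCochain 𝒜 a b (iSec e H) where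
  arg j k es αs i := by
    have := h.arg (j + 1) k (Fin.cons e es) αs i.succ
    simp only [← Fin.cons_update, Fin.val_succ, Nat.add_right_cancel_iff] at this
    exact this
  form j k es αs i := h.form (j + 1) k (Fin.cons e es) αs i
  symm j k es αs σ := h.symm (j + 1) k (Fin.cons e es) αs σ
  swap j k es αs i := swapAt_succ_cons_iff.1 (h.swap (j + 1) k (Fin.cons e es) αs i.succ)

theorem iForm (h : IsOrderCochain 𝒜 a b H) (α : OneForm n M) :
    IsOrderCochain 𝒜 a b (iForm α H) where
  arg j k es αs i := h.arg j (k + 1) es (Fin.cons α αs) i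
  form j k es αs i := by
    have := h.form j (k + 1) es (Fin.cons α αs) i.succ
    simp only [← Fin.cons_update] at this
    exact this
  symm j k es αs σ := by
    simp only [_root_.iForm]
    rw [cons_comp_perm, h.symm]
  swap j k es αs i := by
    refine (h.swap j (k + 1) es (Fin.cons α αs) i).trans (congrArg Neg.neg ?_)
    simp only [_root_.iForm]
    -- The contracted form and the form d⟨e_i, e_{i+1}⟩ from the swap relation appear in opposite
    -- order; symmetry in the one-forms exchanges them.
    rw [← cons_cons_swap, h.symm]

end IsOrderCochain

end Cochains

/-! ### The Lie derivative preserves orders, symmetry and the swap relation -/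

section Cochains

variable {n : ℕ} {M : Type*} [TopologicalSpace M] [ChartedSpace (EuclideanSpace ℝ (Fin n)) M]
  [IsManifold (𝓡 n) ∞ M] [T2Space M]
  {F : Type*} [NormedAddCommGroup F] [NormedSpace ℝ F] [FiniteDimensional ℝ F]
  {E : M → Type*} [∀ x, AddCommGroup (E x)] [∀ x, Module ℝ (E x)] [∀ x, TopologicalSpace (E x)]
  [TopologicalSpace (TotalSpace F E)] [FiberBundle F E] [VectorBundle ℝ F E]
  [ContMDiffVectorBundle ∞ F E (𝓡 n)]
  {W : Type*} [AddCommGroup W] [Module ℝ W] [Module (SmoothFun n M) W]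

theorem isLinDiffOp_lieForm (X : VecField n M) :
    IsLinDiffOp (SmoothFun n M) 1 (lieForm X) :=
  .of_leibniz (fun f => (dForm f).eval X) (lieForm_add_right X)
    (lieForm_const_smul_right X) (lieForm_smul_right X)

omit [FiniteDimensional ℝ F] [ContMDiffVectorBundle ∞ F E (𝓡 n)] in
theorem isLinDiffOp_iotaD_rho (𝒜 : AnchoredMetricBundle n M F E) (α : OneForm n M) :
    IsLinDiffOp (SmoothFun n M) 0 (fun e => iotaD (𝒜.rho e) α) :=
  .of_linear (fun e e' => by rw [𝒜.rho_add, iotaD_add_left])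
    (fun c e => by rw [𝒜.rho_const_smul, iotaD_const_smul_left])
    (fun f e => by rw [𝒜.rho_smul, iotaD_smul_left])

theorem isLinDiffOp_rhoStar (𝒜 : AnchoredMetricBundle n M F E) :
    IsLinDiffOp (SmoothFun n M) 0 𝒜.rhoStar :=
  .of_linear 𝒜.rhoStar_add 𝒜.rhoStar_const_smul 𝒜.rhoStar_smul

variable (𝒜 : CourantAlgebroid n M F E)

theorem isLinDiffOp_bracket_right (e : Sec n F E) :
    IsLinDiffOp (SmoothFun n M) 1 (fun e' => 𝒜.bracket e e') :=
  .of_leibniz (fun f => 𝒜.deriv e f) (map_add _) (map_smul _) (𝒜.bracket_smul_right e)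

theorem isLinDiffOp_bracket_left (e' : Sec n F E) :
    IsLinDiffOp (SmoothFun n M) 1 (fun e => 𝒜.bracket e e') :=
  .of_symbol (fun f e => 𝒜.inner e e' • 𝒜.dE f - 𝒜.deriv e' f • e)
    (fun e₁ e₂ => by rw [map_add, LinearMap.add_apply])
    (fun c e => by rw [map_smul, LinearMap.smul_apply])
    (fun f e => by rw [𝒜.bracket_smul_left]; abel)
    (fun f g e => by
      rw [𝒜.inner_smul_left, mul_smul, smul_comm (𝒜.deriv e' f) g e, smul_sub])

variable {𝒜} {D : Sec n F E → W → W}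

omit [T2Space M] [Module ℝ W] [Module (SmoothFun n M) W] in
theorem lieD_add (hD : ∀ e w w', D e (w + w') = D e w + D e w') (e : Sec n F E)
    (H H' : Cochain n F E W) : lieD 𝒜 D e (H + H') = lieD 𝒜 D e H + lieD 𝒜 D e H' := by
  funext j k es αs
  simp only [lieD, Pi.add_apply, hD, Finset.sum_add_distrib]
  abel

omit [T2Space M] [Module ℝ W] [Module (SmoothFun n M) W] in
theorem lieD_neg (hD : ∀ e w, D e (-w) = - D e w) (e : Sec n F E)
    (H : Cochain n F E W) : lieD 𝒜 D e (-H) = - lieD 𝒜 D e H := by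
  funext j k es αs
  simp only [lieD, Pi.neg_apply, hD, Finset.sum_neg_distrib]
  abel

namespace IsOrderCochain

variable {m : ℕ} {H : Cochain n F E W}

theorem lieD_arg (hD : IsSecAction 𝒜.toAnchoredMetricBundle D)
    (h : IsOrderCochain 𝒜.toAnchoredMetricBundle m m H) (e : Sec n F E) (j k : ℕ)
    (es : Fin j → Sec n F E) (αs : Fin k → OneForm n M) (i : Fin j) :
    IsLinDiffOp (SmoothFun n M) m (fun e' => lieD 𝒜 D e H j k (update es i e') αs) := by
  induction j generalizing H with
  | zero => exact i.elim0
  | succ j ih =>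
    obtain ⟨e₀, es, rfl⟩ := exists_eq_cons es
    refine Fin.cases ?_ (fun i => ?_) i
    -- In the first slot, D_e(H(e', …)) - H([e, e'], …) is the commutator of e' ↦ H(e', …) with
    -- derivations over ρ(e), so it keeps the order m. The remaining terms merely change the other
    -- arguments.
    · have h1 := (h.arg_cons' j k es αs).lie (fun f => 𝒜.deriv e f)
        (isLinDiffOp_bracket_right 𝒜 e) (hD.right e) (𝒜.bracket_smul_right e) (hD.leibniz e)
      have h2 : IsLinDiffOp (SmoothFun n M) m (fun e' => ∑ μ : Fin k,
          H (j + 1) k (Fin.cons e' es) (update αs μ (lieForm (𝒜.rho e) (αs μ)))) :=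
        .sum _ fun μ _ => h.arg_cons' j k es _
      have h3 : IsLinDiffOp (SmoothFun n M) m (fun e' => ∑ l : Fin j,
          H (j + 1) k (Fin.cons e' (update es l (𝒜.bracket e (es l)))) αs) :=
        .sum _ fun l _ => h.arg_cons' j k _ αs
      refine Eq.mp (congrArg _ (funext fun e' => ?_)) ((h1.sub h2).sub h3)
      rw [Fin.update_cons_zero, lieD_cons]
      simp only [lieD, _root_.iSec]
      abel
    · simp only [← Fin.cons_update, lieD_cons]
      exact (ih (h.iSec e₀) es i).sub ((h.iSec _).arg_update j k es αs i)

theorem lieD_form (hD : IsSecAction 𝒜.toAnchoredMetricBundle D)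
    (h : IsOrderCochain 𝒜.toAnchoredMetricBundle m m H) (e : Sec n F E) (j k : ℕ)
    (es : Fin j → Sec n F E) (αs : Fin k → OneForm n M) (i : Fin k) :
    IsLinDiffOp (SmoothFun n M) m (fun α => lieD 𝒜 D e H j k es (update αs i α)) := by
  induction k generalizing H with
  | zero => exact i.elim0
  | succ k ih =>
    obtain ⟨α₀, αs, rfl⟩ := exists_eq_cons αs
    refine Fin.cases ?_ (fun i => ?_) i
    · have h1 := (h.form_cons j k es αs).lie (fun f => 𝒜.deriv e f)
        (isLinDiffOp_lieForm (𝒜.rho e)) (hD.right e) (lieForm_smul_right (𝒜.rho e)) (hD.leibniz e)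
      have h2 : IsLinDiffOp (SmoothFun n M) m (fun α => ∑ μ : Fin k,
          H j (k + 1) es (Fin.cons α (update αs μ (lieForm (𝒜.rho e) (αs μ))))) :=
        .sum _ fun μ _ => h.form_cons j k es _
      have h3 : IsLinDiffOp (SmoothFun n M) m (fun α => ∑ l : Fin j,
          H j (k + 1) (update es l (𝒜.bracket e (es l))) (Fin.cons α αs)) :=
        .sum _ fun l _ => h.form_cons j k _ αs
      refine Eq.mp (congrArg _ (funext fun α => ?_)) ((h1.sub h2).sub h3)
      rw [Fin.update_cons_zero, lieD_form_cons]
      simp only [lieD, _root_.iForm]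
      abel
    · simp only [← Fin.cons_update, lieD_form_cons]
      exact (ih (h.iForm α₀) αs i).sub ((h.iForm _).form j k es αs i)

omit [T2Space M] in
theorem lieD_symm (h : IsOrderCochain 𝒜.toAnchoredMetricBundle m m H) (e : Sec n F E) (j k : ℕ)
    (es : Fin j → Sec n F E) (αs : Fin k → OneForm n M) (σ : Equiv.Perm (Fin k)) :
    lieD 𝒜 D e H j k es (αs ∘ σ) = lieD 𝒜 D e H j k es αs := by
  have h1 (μ : Fin k) : H j k es (update (αs ∘ σ) μ (lieForm (𝒜.rho e) ((αs ∘ σ) μ))) =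
      H j k es (update αs (σ μ) (lieForm (𝒜.rho e) (αs (σ μ)))) := by
    rw [← h.symm j k es (update αs (σ μ) _) σ,
      Function.update_comp_eq_of_injective _ σ.injective]
    rfl
  simp only [lieD, h1, h.symm]
  rw [Equiv.sum_comp σ (fun μ => H j k es (update αs μ (lieForm (𝒜.rho e) (αs μ))))]

/-- For the first two arguments a, b, put f = ⟨a, b⟩. Symmetrising leaves -L_e(i_f H) plus the swap
terms of the pairs ([e, a], b) and (a, [e, b]). By invariance of the metric these add up to
i_{ρ(e)(f)}H, and L_{ρ(e)}df = d(ρ(e)(f)) turns the total into -i_f(L_e H). -/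
theorem lieD_swapAt (hD : IsSecAction 𝒜.toAnchoredMetricBundle D)
    (h : IsOrderCochain 𝒜.toAnchoredMetricBundle m m H) (e : Sec n F E) (j k : ℕ)
    (es : Fin (j + 2) → Sec n F E) (αs : Fin k → OneForm n M) (i : Fin (j + 1)) :
    SwapAt 𝒜.toAnchoredMetricBundle (lieD 𝒜 D e H) j k es αs i := by
  have zero (j : ℕ) {H : Cochain n F E W} (h : IsOrderCochain 𝒜.toAnchoredMetricBundle m m H)
      (es : Fin (j + 2) → Sec n F E) :
      SwapAt 𝒜.toAnchoredMetricBundle (lieD 𝒜 D e H) j k es αs 0 := by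
    obtain ⟨a, es, rfl⟩ := exists_eq_cons es
    obtain ⟨b, es, rfl⟩ := exists_eq_cons es
    rw [swapAt_zero_cons_iff]
    have hcons (a b : Sec n F E) : lieD 𝒜 D e H (j + 2) k
        (Fin.cons a (Fin.cons b es : Fin (j + 1) → Sec n F E)) αs =
        lieD 𝒜 D e (_root_.iSec b (_root_.iSec a H)) j k es αs -
          H (j + 2) k (Fin.cons a (Fin.cons (𝒜.bracket e b) es : Fin (j + 1) → Sec n F E)) αs -
          H (j + 2) k (Fin.cons (𝒜.bracket e a) (Fin.cons b es : Fin (j + 1) → Sec n F E)) αs := by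
      rw [lieD_cons, lieD_cons]
      rfl
    have h1 := congrArg (fun G => lieD 𝒜 D e G j k es αs) (h.iSec_iSec b a)
    simp only [lieD_add (fun e => (hD.right e).map_add), lieD_neg (fun e => (hD.right e).map_neg),
      Pi.add_apply, Pi.neg_apply] at h1
    have h2 := h.swap_zero j k (𝒜.bracket e a) b es αs
    have h3 := h.swap_zero j k a (𝒜.bracket e b) es αs
    have h4 := (h.form_cons j k es αs).map_add (dForm (𝒜.inner (𝒜.bracket e a) b))
      (dForm (𝒜.inner a (𝒜.bracket e b)))
    rw [← dForm_add, ← 𝒜.deriv_inner] at h4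
    rw [hcons, hcons, lieD_form_cons, lieForm_dForm]
    simp only [iFun, _root_.iForm] at h1 ⊢
    rw [𝒜.inner_comm b a] at h1
    have h5 : (dForm (𝒜.inner a b)).eval (𝒜.rho e) = 𝒜.deriv e (𝒜.inner a b) := rfl
    rw [h5, h4]
    have h6 := congrArg₂ (· + ·) h1 (congrArg₂ (fun x y => - x - y) h2 h3)
    rw [← sub_eq_zero] at h6 ⊢
    rw [← h6]
    abel
  induction j generalizing H with
  | zero =>
    rw [Subsingleton.elim (α := Fin 1) i 0]
    exact zero 0 h es
  | succ j ih =>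
    refine Fin.cases (zero _ h es) (fun i => ?_) i
    obtain ⟨a, es, rfl⟩ := exists_eq_cons es
    rw [swapAt_succ_cons_iff]
    have : _root_.iSec a (lieD 𝒜 D e H) =
        lieD 𝒜 D e (_root_.iSec a H) - _root_.iSec (𝒜.bracket e a) H := by
      funext j k es αs
      exact lieD_cons 𝒜 D e a H j k es αs
    rw [this]
    exact (ih (h.iSec a) es i).sub ((h.iSec _).swap j k es αs i)

theorem lieD (hD : IsSecAction 𝒜.toAnchoredMetricBundle D)
    (h : IsOrderCochain 𝒜.toAnchoredMetricBundle m m H) (e : Sec n F E) :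
    IsOrderCochain 𝒜.toAnchoredMetricBundle m m (lieD 𝒜 D e H) where
  arg j k es αs i := by simpa only [ite_self] using h.lieD_arg hD e j k es αs i
  form := h.lieD_form hD e
  symm := h.lieD_symm e
  swap := h.lieD_swapAt hD e

end IsOrderCochain

end Cochains

/-! ### Cartan's formula and the mapping properties of the differential -/

section Cochains

variable {n : ℕ} {M : Type*} [TopologicalSpace M] [ChartedSpace (EuclideanSpace ℝ (Fin n)) M]
  [IsManifold (𝓡 n) ∞ M] [T2Space M]
  {F : Type*} [NormedAddCommGroup F] [NormedSpace ℝ F] [FiniteDimensional ℝ F]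
  {E : M → Type*} [∀ x, AddCommGroup (E x)] [∀ x, Module ℝ (E x)] [∀ x, TopologicalSpace (E x)]
  [TopologicalSpace (TotalSpace F E)] [FiberBundle F E] [VectorBundle ℝ F E]
  [ContMDiffVectorBundle ∞ F E (𝓡 n)]
  {W : Type*} [AddCommGroup W] [Module ℝ W] [Module (SmoothFun n M) W]

variable {𝒜 : CourantAlgebroid n M F E} {D : Sec n F E → W → W} {a b m : ℕ} {H : Cochain n F E W}

section

omit [T2Space M]

omit [Module ℝ W] [Module (SmoothFun n M) W] in
theorem cochainDiff_add (hD : ∀ e w w', D e (w + w') = D e w + D e w') (H H' : Cochain n F E W) :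
    cochainDiff 𝒜 D (H + H') = cochainDiff 𝒜 D H + cochainDiff 𝒜 D H' := by
  have h1 : diffPartForm 𝒜 (H + H') = diffPartForm 𝒜 H + diffPartForm 𝒜 H' := by
    funext j k es αs
    cases k with
    | zero => simp [diffPartForm]
    | succ k => simp only [diffPartForm, Pi.add_apply, Finset.sum_add_distrib]
  have h2 : diffPartDeriv 𝒜 D (H + H') = diffPartDeriv 𝒜 D H + diffPartDeriv 𝒜 D H' := by
    funext j k es αs
    cases j with
    | zero => simp [diffPartDeriv]
    | succ j =>
      simp only [diffPartDeriv, Pi.add_apply, ← Finset.sum_add_distrib, hD]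
      refine Finset.sum_congr rfl fun i _ => ?_
      rw [← smul_add, Finset.sum_add_distrib, add_sub_add_comm]
  have h3 : diffPartBracket 𝒜 (H + H') = diffPartBracket 𝒜 H + diffPartBracket 𝒜 H' := by
    funext j k es αs
    cases j with
    | zero => simp [diffPartBracket]
    | succ j => simp only [diffPartBracket, Pi.add_apply, smul_add, Finset.sum_add_distrib]
  rw [cochainDiff, h1, h2, h3, cochainDiff, cochainDiff]
  abel

omit [Module ℝ W] [Module (SmoothFun n M) W] in
theorem cochainDiff_zero (hD : ∀ e, D e 0 = 0) : cochainDiff 𝒜 D 0 = 0 := by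
  funext j k es αs
  rcases j with _ | j <;> rcases k with _ | k <;>
    simp [cochainDiff, diffPartForm, diffPartDeriv, diffPartBracket, hD]

/-- Moving ρ*α_μ behind e by the swap relation costs a term with the form d⟨ρ*α_μ, e⟩ =
d(α_μ(ρ(e))), precisely the difference between `iotaD` and `lieForm`. -/
theorem diffPartForm_cons (h : IsOrderCochain 𝒜.toAnchoredMetricBundle a b H) (e : Sec n F E)
    (j k : ℕ) (es : Fin j → Sec n F E) (αs : Fin k → OneForm n M) :
    diffPartForm 𝒜 H (j + 1) k (Fin.cons e es) αs =
      - diffPartForm 𝒜 (iSec e H) j k es αs -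
        ∑ μ : Fin k, H j k es (update αs μ (dForm ((αs μ).eval (𝒜.rho e)))) := by
  cases k with
  | zero => simp [diffPartForm]
  | succ k =>
    simp only [diffPartForm, ← Finset.sum_neg_distrib, ← Finset.sum_sub_distrib]
    refine Finset.sum_congr rfl fun μ _ => ?_
    -- The swap relation puts the new form in front of the list without α_μ; a cyclic permutation
    -- takes it to position μ.
    have h1 := Fin.cons_removeNth_eq_comp_cycleRange_symm
      (update αs μ (dForm ((αs μ).eval (𝒜.rho e)))) μ
    rw [Function.update_self, Fin.removeNth_update] at h1
    rw [eq_sub_of_add_eq (h.swap_zero j k (𝒜.rhoStar (αs μ)) e es (μ.removeNth αs)),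
      𝒜.inner_rhoStar, h1, h.symm, iSec]
    abel

/-- Cartan's formula i_e d = L_e - d i_e: the first-slot terms of the three parts of d add up to L_e
H, the d(α_μ(ρ(e))) terms completing i_{ρ(e)}dα_μ to the Lie derivative. -/
theorem cochainDiff_cons (h : IsOrderCochain 𝒜.toAnchoredMetricBundle a b H) (e : Sec n F E)
    (j k : ℕ) (es : Fin j → Sec n F E) (αs : Fin k → OneForm n M) :
    cochainDiff 𝒜 D H (j + 1) k (Fin.cons e es) αs =
      lieD 𝒜 D e H j k es αs - cochainDiff 𝒜 D (iSec e H) j k es αs := by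
  have h1 (μ : Fin k) : H j k es (update αs μ (lieForm (𝒜.rho e) (αs μ))) =
      H j k es (update αs μ (iotaD (𝒜.rho e) (αs μ))) +
        H j k es (update αs μ (dForm ((αs μ).eval (𝒜.rho e)))) :=
    (h.form j k es αs μ).map_add _ _
  simp only [cochainDiff, Pi.add_apply, diffPartForm_cons h, diffPartDeriv_cons,
    diffPartBracket_cons, lieD, h1, Finset.sum_add_distrib]
  abel

theorem iSec_cochainDiff (h : IsOrderCochain 𝒜.toAnchoredMetricBundle a b H) (e : Sec n F E) :
    iSec e (cochainDiff 𝒜 D H) = lieD 𝒜 D e H - cochainDiff 𝒜 D (iSec e H) := by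
  funext j k es αs
  exact cochainDiff_cons h e j k es αs

end

omit [Module ℝ W] [Module (SmoothFun n M) W] in
/-- The commutator of the differential with the contraction by an exact one-form. -/
theorem iFun_cochainDiff (h : ∀ j k es αs, H j (k + 1) es (Fin.cons 0 αs) = 0)
    (f : SmoothFun n M) :
    iFun f (cochainDiff 𝒜 D H) = cochainDiff 𝒜 D (iFun f H) + iSec (𝒜.dE f) H := by
  funext j k es αs
  have h2 : diffPartDeriv 𝒜 D H j (k + 1) es (Fin.cons (dForm f) αs) =
      diffPartDeriv 𝒜 D (iFun f H) j k es αs := by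
    cases j with
    | zero => rfl
    | succ j =>
      simp only [diffPartDeriv, iFun, iForm]
      refine Finset.sum_congr rfl fun i _ => ?_
      -- The term that differentiates the form df itself is H evaluated on i_{ρ(e_i)}d(df) = 0.
      rw [Fin.sum_univ_succ, Fin.cons_zero, iotaD_dForm, Fin.update_cons_zero, h, zero_add]
      simp only [Fin.cons_succ, Fin.cons_update]
  have h3 : diffPartBracket 𝒜 H j (k + 1) es (Fin.cons (dForm f) αs) =
      diffPartBracket 𝒜 (iFun f H) j k es αs := by
    cases j with
    | zero => rfl
    | succ j => rfl
  have h4 : iFun f (cochainDiff 𝒜 D H) j k es αs =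
    diffPartForm 𝒜 H j (k + 1) es (Fin.cons (dForm f) αs) +
      diffPartDeriv 𝒜 D H j (k + 1) es (Fin.cons (dForm f) αs) +
      diffPartBracket 𝒜 H j (k + 1) es (Fin.cons (dForm f) αs) := rfl
  rw [h4, h2, h3, diffPartForm_form_cons]
  simp only [cochainDiff, Pi.add_apply, iFun, iSec, AnchoredMetricBundle.dE]
  abel

namespace IsOrderCochain

section

omit [T2Space M]

theorem diffPartForm_symm (h : IsOrderCochain 𝒜.toAnchoredMetricBundle a b H) (j k : ℕ)
    (es : Fin j → Sec n F E) (αs : Fin k → OneForm n M) (σ : Equiv.Perm (Fin k)) :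
    diffPartForm 𝒜 H j k es (αs ∘ σ) = diffPartForm 𝒜 H j k es αs := by
  cases k with
  | zero => rfl
  | succ k =>
    simp only [diffPartForm]
    rw [← Equiv.sum_comp σ (fun μ =>
      H (j + 1) k (Fin.cons (𝒜.rhoStar (αs μ)) es) (μ.removeNth αs))]
    refine Finset.sum_congr rfl fun μ _ => ?_
    obtain ⟨τ, hτ⟩ := exists_removeNth_comp_perm αs σ μ
    rw [hτ, h.symm]
    rfl

theorem diffPartForm_arg_cons (h : IsOrderCochain 𝒜.toAnchoredMetricBundle m m H) (j k : ℕ)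
    (es : Fin j → Sec n F E) (αs : Fin k → OneForm n M) :
    IsLinDiffOp (SmoothFun n M) m
      (fun e => diffPartForm 𝒜 H (j + 1) k (Fin.cons e es) αs) := by
  cases k with
  | zero => exact .zero m
  | succ k => exact .sum _ fun μ _ => (h.iSec _).arg_cons' j k es _

theorem diffPartForm_iForm_cons (h : IsOrderCochain 𝒜.toAnchoredMetricBundle m m H) (j k : ℕ)
    (es : Fin j → Sec n F E) (αs : Fin k → OneForm n M) :
    IsLinDiffOp (SmoothFun n M) m (fun α => diffPartForm 𝒜 (_root_.iForm α H) j k es αs) := by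
  cases k with
  | zero => exact .zero m
  | succ k => exact .sum _ fun μ _ => h.form_cons (j + 1) k _ _

theorem diffPartDeriv_iSec (hD : IsSecAction 𝒜.toAnchoredMetricBundle D)
    (h : IsOrderCochain 𝒜.toAnchoredMetricBundle m m H) (j k : ℕ)
    (es : Fin j → Sec n F E) (αs : Fin k → OneForm n M) :
    IsLinDiffOp (SmoothFun n M) (if j = 0 then m else m + 1)
      (fun e => diffPartDeriv 𝒜 D (_root_.iSec e H) j k es αs) := by
  cases j with
  | zero => exact .zero _
  | succ j =>
    refine .sum _ fun i _ => (IsLinDiffOp.sub ?_ ?_).neg_one_pow_smul _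
    · exact (hD.right _).comp_le (h.arg_cons' j k _ _) (by simp [add_comm])
    · exact .sum _ fun μ _ => (h.arg_cons' j k _ _).mono (by simp)

theorem diffPartBracket_iSec (h : IsOrderCochain 𝒜.toAnchoredMetricBundle m m H) (j k : ℕ)
    (es : Fin j → Sec n F E) (αs : Fin k → OneForm n M) :
    IsLinDiffOp (SmoothFun n M) m
      (fun e => diffPartBracket 𝒜 (_root_.iSec e H) j k es αs) := by
  cases j with
  | zero => exact .zero _
  | succ j =>
    exact .sum _ fun i _ => .sum _ fun l _ => (h.arg_cons' j k _ _).neg_one_pow_smul _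

end

/-- Order m + 1 arises in two ways only: from D_{e_i} applied to a value depending on e, and from
[e, e_l], which is first order in e. Both need a further section, so a sole section keeps order m.
The term `D e (H j k es αs)` has order 1, which is where 1 ≤ m enters. -/
theorem cochainDiff_arg_cons (hm : 1 ≤ m) (hD : IsSecAction 𝒜.toAnchoredMetricBundle D)
    (h : IsOrderCochain 𝒜.toAnchoredMetricBundle m m H) (j k : ℕ)
    (es : Fin j → Sec n F E) (αs : Fin k → OneForm n M) :
    IsLinDiffOp (SmoothFun n M) (if j = 0 then m else m + 1)
      (fun e => cochainDiff 𝒜 D H (j + 1) k (Fin.cons e es) αs) := by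
  have hle : m ≤ if j = 0 then m else m + 1 := by split_ifs <;> omega
  have h1 := (h.diffPartForm_arg_cons j k es αs).mono hle
  have h2 := (hD.left (H j k es αs)).mono (hm.trans hle)
  have h3 : IsLinDiffOp (SmoothFun n M) (if j = 0 then m else m + 1)
      (fun e => ∑ μ : Fin k, H j k es (update αs μ (iotaD (𝒜.rho e) (αs μ)))) :=
    .sum _ fun μ _ => (h.form j k es αs μ).comp_le
      (isLinDiffOp_iotaD_rho 𝒜.toAnchoredMetricBundle (αs μ)) hle
  have h4 := h.diffPartDeriv_iSec hD j k es αs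
  have h5 : IsLinDiffOp (SmoothFun n M) (if j = 0 then m else m + 1)
      (fun e => ∑ l : Fin j, H j k (update es l (𝒜.bracket e (es l))) αs) := by
    refine .sum _ fun l _ => (h.arg_update j k es αs l).comp_le
      (isLinDiffOp_bracket_left 𝒜 (es l)) ?_
    rw [if_neg (by have := l.pos; omega)]
  have h6 := (h.diffPartBracket_iSec j k es αs).mono hle
  simp only [cochainDiff, Pi.add_apply, diffPartDeriv_cons, diffPartBracket_cons]
  exact (h1.add ((h2.sub h3).sub h4)).add (h5.neg.sub h6)

theorem cochainDiff_arg (hm : 1 ≤ m) (hD : IsSecAction 𝒜.toAnchoredMetricBundle D)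
    (h : IsOrderCochain 𝒜.toAnchoredMetricBundle m m H) (j k : ℕ)
    (es : Fin j → Sec n F E) (αs : Fin k → OneForm n M) (i : Fin j) :
    IsLinDiffOp (SmoothFun n M) (if (i : ℕ) + 1 = j then m else m + 1)
      (fun e => cochainDiff 𝒜 D H j k (update es i e) αs) := by
  induction j generalizing H with
  | zero => exact i.elim0
  | succ j ih =>
    obtain ⟨e₀, es, rfl⟩ := exists_eq_cons es
    refine Fin.cases ?_ (fun i => ?_) i
    · have hj : ((0 : Fin (j + 1)) : ℕ) + 1 = j + 1 ↔ j = 0 := by simp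
      simp only [Fin.update_cons_zero, hj]
      exact h.cochainDiff_arg_cons hm hD j k es αs
    · simp only [← Fin.cons_update, cochainDiff_cons h, Fin.val_succ, Nat.add_right_cancel_iff]
      -- Contraction from the front keeps the last argument last, and the Lie derivative has order m
      -- there, so the better bound survives the recursion.
      refine (((h.lieD hD e₀).arg_update j k es αs i).mono ?_).sub (ih (h.iSec e₀) es i)
      split_ifs <;> omega

/-- Each term here has order at most m, since ρ* is linear over C^∞(M) and the Lie derivative keeps
orders; m + 1 is the bound shared with the non-last sections. -/
theorem cochainDiff_form (hD : IsSecAction 𝒜.toAnchoredMetricBundle D)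
    (h : IsOrderCochain 𝒜.toAnchoredMetricBundle m m H) (j k : ℕ)
    (es : Fin j → Sec n F E) (αs : Fin k → OneForm n M) (i : Fin k) :
    IsLinDiffOp (SmoothFun n M) (m + 1)
      (fun α => cochainDiff 𝒜 D H j k es (update αs i α)) := by
  induction j generalizing H with
  | zero =>
    simp only [cochainDiff_zero_left]
    induction k generalizing H with
    | zero => exact i.elim0
    | succ k ih =>
      obtain ⟨α₀, αs, rfl⟩ := exists_eq_cons αs
      refine Fin.cases ?_ (fun i => ?_) i
      · simp only [Fin.update_cons_zero, diffPartForm_form_cons]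
        exact ((h.arg_cons' 0 k es αs).comp_le (isLinDiffOp_rhoStar 𝒜.toAnchoredMetricBundle)
          (Nat.le_succ m)).add ((h.diffPartForm_iForm_cons 0 k es αs).mono (Nat.le_succ m))
      · simp only [← Fin.cons_update, diffPartForm_form_cons]
        exact (((h.iSec _).form 0 k es αs i).mono (Nat.le_succ m)).add (ih αs i (h.iForm α₀))
  | succ j ih =>
    obtain ⟨e₀, es, rfl⟩ := exists_eq_cons es
    simp only [cochainDiff_cons h]
    exact (((h.lieD hD e₀).form j k es αs i).mono (Nat.le_succ m)).sub (ih (h.iSec e₀) es)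

theorem cochainDiff_symm (hD : IsSecAction 𝒜.toAnchoredMetricBundle D)
    (h : IsOrderCochain 𝒜.toAnchoredMetricBundle m m H) (j k : ℕ)
    (es : Fin j → Sec n F E) (αs : Fin k → OneForm n M) (σ : Equiv.Perm (Fin k)) :
    cochainDiff 𝒜 D H j k es (αs ∘ σ) = cochainDiff 𝒜 D H j k es αs := by
  induction j generalizing H with
  | zero => rw [cochainDiff_zero_left, cochainDiff_zero_left, h.diffPartForm_symm]
  | succ j ih =>
    obtain ⟨e₀, es, rfl⟩ := exists_eq_cons es
    rw [cochainDiff_cons h, cochainDiff_cons h, ih (h.iSec e₀), (h.lieD hD e₀).symm]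

/-- Applying Cartan's formula twice, the Lie derivative terms are antisymmetric in e, e' and cancel.
With f = ⟨e, e'⟩ there remains d(i_{e'} i_e + i_e i_{e'})H - i_{[e, e'] + [e', e]}H = -d(i_f H) -
i_{d_E f}H = -i_f(dH). -/
theorem cochainDiff_swapAt (hD : IsSecAction 𝒜.toAnchoredMetricBundle D)
    (h : IsOrderCochain 𝒜.toAnchoredMetricBundle m m H) (j k : ℕ)
    (es : Fin (j + 2) → Sec n F E) (αs : Fin k → OneForm n M) (i : Fin (j + 1)) :
    SwapAt 𝒜.toAnchoredMetricBundle (cochainDiff 𝒜 D H) j k es αs i := by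
  have hadd (H H' : Cochain n F E W) :=
    cochainDiff_add (𝒜 := 𝒜) (fun e => (hD.right e).map_add) H H'
  have zero (j : ℕ) {H : Cochain n F E W} (h : IsOrderCochain 𝒜.toAnchoredMetricBundle m m H)
      (es : Fin (j + 2) → Sec n F E) :
      SwapAt 𝒜.toAnchoredMetricBundle (cochainDiff 𝒜 D H) j k es αs 0 := by
    obtain ⟨e, es, rfl⟩ := exists_eq_cons es
    obtain ⟨e', es, rfl⟩ := exists_eq_cons es
    rw [swapAt_zero_cons_iff]
    have hcons (e e' : Sec n F E) : cochainDiff 𝒜 D H (j + 2) k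
        (Fin.cons e (Fin.cons e' es : Fin (j + 1) → Sec n F E)) αs =
        cochainDiff 𝒜 D (_root_.iSec e' (_root_.iSec e H)) j k es αs -
          H (j + 1) k (Fin.cons (𝒜.bracket e e') es) αs +
          (_root_.lieD 𝒜 D e (_root_.iSec e' H) j k es αs -
            _root_.lieD 𝒜 D e' (_root_.iSec e H) j k es αs) := by
      rw [cochainDiff_cons h, lieD_cons, cochainDiff_cons (h.iSec e)]
      simp only [_root_.iSec]
      abel
    have h1 : cochainDiff 𝒜 D (_root_.iSec e' (_root_.iSec e H)) j k es αs +
        cochainDiff 𝒜 D (_root_.iSec e (_root_.iSec e' H)) j k es αs +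
        cochainDiff 𝒜 D (iFun (𝒜.inner e e') H) j k es αs = 0 := by
      have hz : _root_.iSec e' (_root_.iSec e H) + _root_.iSec e (_root_.iSec e' H) +
          iFun (𝒜.inner e e') H = 0 := by
        rw [h.iSec_iSec, 𝒜.inner_comm, neg_add_cancel]
      have h0 := (congrArg (_root_.cochainDiff 𝒜 D) hz).trans
        (cochainDiff_zero fun e => (hD.right e).map_zero)
      rw [hadd, hadd] at h0
      exact congrFun (congrFun (congrFun (congrFun h0 j) k) es) αs
    have h2 := (h.arg_cons' j k es αs).map_add (𝒜.bracket e e') (𝒜.bracket e' e)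
    rw [𝒜.bracket_add_swap] at h2
    have h3 := congrFun (congrFun (congrFun (congrFun (iFun_cochainDiff (𝒜 := 𝒜) (D := D)
      h.form_cons_zero (𝒜.inner e e')) j) k) es) αs
    change cochainDiff 𝒜 D H j (k + 1) es _ = cochainDiff 𝒜 D _ j k es αs +
      H (j + 1) k (Fin.cons (𝒜.dE (𝒜.inner e e')) es) αs at h3
    rw [hcons, hcons, h3, h2, ← sub_eq_zero, ← h1]
    abel
  induction j generalizing H with
  | zero =>
    rw [Subsingleton.elim (α := Fin 1) i 0]
    exact zero 0 h es
  | succ j ih =>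
    refine Fin.cases (zero _ h es) (fun i => ?_) i
    obtain ⟨e, es, rfl⟩ := exists_eq_cons es
    rw [swapAt_succ_cons_iff, iSec_cochainDiff h]
    exact SwapAt.sub ((h.lieD hD e).swap j k es αs i) (ih (h.iSec e) es i)

/-- The differential raises the order by one, except in the last argument. -/
theorem cochainDiff (hm : 1 ≤ m) (hD : IsSecAction 𝒜.toAnchoredMetricBundle D)
    (h : IsOrderCochain 𝒜.toAnchoredMetricBundle m m H) :
    IsOrderCochain 𝒜.toAnchoredMetricBundle (m + 1) m (cochainDiff 𝒜 D H) where
  arg := h.cochainDiff_arg hm hD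
  form := h.cochainDiff_form hD
  symm := h.cochainDiff_symm hD
  swap := h.cochainDiff_swapAt hD

end IsOrderCochain

end Cochains

/-! ### Signs of shuffles -/

section Shuffles

theorem orderEmbOfFin_univ_eq_id (k : ℕ) :
    ((Finset.univ : Finset (Fin k)).orderEmbOfFin (by simp) : Fin k → Fin k) = id :=
  (Finset.orderEmbOfFin_unique _ (fun _ => Finset.mem_univ _) strictMono_id).symm

theorem shuffleSign_univ (j : ℕ) : shuffleSign (Finset.univ : Finset (Fin j)) = 1 := by
  simp [shuffleSign]

/-- Moving position i to the end creates one inversion with each later position, and there are j - i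
of these. -/
theorem shuffleSign_compl_singleton {j : ℕ} (i : Fin (j + 1)) :
    shuffleSign ({i}ᶜ : Finset (Fin (j + 1))) = (-1) ^ (j - i : ℕ) := by
  have h : ((({i}ᶜ : Finset (Fin (j + 1))) ×ˢ ({i}ᶜ : Finset (Fin (j + 1)))ᶜ).filter
      fun a => a.2 < a.1) = (Finset.Ioi i) ×ˢ {i} := by
    ext ⟨a, b⟩
    simp only [compl_compl, Finset.mem_filter, Finset.mem_product, Finset.mem_compl,
      Finset.mem_singleton, Finset.mem_Ioi]
    constructor
    · rintro ⟨⟨_, rfl⟩, h⟩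
      exact ⟨h, rfl⟩
    · rintro ⟨h, rfl⟩
      exact ⟨⟨h.ne', rfl⟩, h⟩
  rw [shuffleSign, h, Finset.card_product, Finset.card_singleton, mul_one, Fin.card_Ioi]
  simp

end Shuffles

/-! ### Products with cochains that have a single component -/

section Cochains

variable {n : ℕ} {M : Type*} [TopologicalSpace M] [ChartedSpace (EuclideanSpace ℝ (Fin n)) M]
  [IsManifold (𝓡 n) ∞ M] [T2Space M]
  {F : Type*} [NormedAddCommGroup F] [NormedSpace ℝ F] [FiniteDimensional ℝ F]
  {E : M → Type*} [∀ x, AddCommGroup (E x)] [∀ x, Module ℝ (E x)] [∀ x, TopologicalSpace (E x)]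
  [TopologicalSpace (TotalSpace F E)] [FiberBundle F E] [VectorBundle ℝ F E]
  [ContMDiffVectorBundle ∞ F E (𝓡 n)]
  {W : Type*} [AddCommGroup W] [Module ℝ W] [Module (SmoothFun n M) W]

section Mul

omit [FiniteDimensional ℝ F] [ContMDiffVectorBundle ∞ F E (𝓡 n)] [T2Space M] [Module ℝ W]
  [∀ x, Module ℝ (E x)] [VectorBundle ℝ F E]

omit [AddCommGroup W] [Module (SmoothFun n M) W] [∀ x, AddCommGroup (E x)] in
-- Component indices in a product are cardinalities of finsets; this exchanges them for the numbers
-- they equal without casts on tuples.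
theorem Cochain.apply_orderEmbOfFin (H : Cochain n F E W) {j k a c : ℕ} (S : Finset (Fin j))
    (T : Finset (Fin k)) (hS : S.card = a) (hT : T.card = c) (es : Fin j → Sec n F E)
    (αs : Fin k → OneForm n M) :
    H S.card T.card (es ∘ S.orderEmbOfFin rfl) (αs ∘ T.orderEmbOfFin rfl) =
      H a c (es ∘ S.orderEmbOfFin hS) (αs ∘ T.orderEmbOfFin hT) := by
  subst hS hT
  rfl

/-- Multiplication with a cochain that is concentrated in the components without one-forms. -/
theorem Cochain.mul_apply_of_form_eq_zero (η : Cochain n F E (SmoothFun n M)) (K : Cochain n F E W)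
    (hK : ∀ j k, k ≠ 0 → K j k = 0) (j k : ℕ) (es : Fin j → Sec n F E)
    (αs : Fin k → OneForm n M) :
    η.mul K j k es αs = ∑ S : Finset (Fin j), shuffleSign S •
      (η S.card k (es ∘ S.orderEmbOfFin rfl) αs •
        K Sᶜ.card 0 (es ∘ Sᶜ.orderEmbOfFin rfl) Fin.elim0) := by
  refine Finset.sum_congr rfl fun S _ => ?_
  -- The second factor takes the one-forms in `Tᶜ` and vanishes unless there are none.
  rw [Finset.sum_eq_single Finset.univ]
  · congr 2
    · rw [η.apply_orderEmbOfFin S Finset.univ rfl (Finset.card_fin k), orderEmbOfFin_univ_eq_id]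
      rfl
    · rw [K.apply_orderEmbOfFin Sᶜ Finset.univᶜ rfl (c := 0) (by simp)]
      congr 1
      exact Subsingleton.elim _ _
  · intro T _ hT
    rw [hK _ _ (by simpa using hT)]
    simp
  · simp

/-- Multiplication with an element of the values. -/
theorem Cochain.mul_ofElem (η : Cochain n F E (SmoothFun n M)) (w : W) :
    η.mul (Cochain.ofElem w) = η.tensor w := by
  funext j k es αs
  have hK : ∀ j k, j ≠ 0 ∨ k ≠ 0 → (Cochain.ofElem w : Cochain n F E W) j k = 0 := by
    intro j k h
    rcases j with _ | j <;> rcases k with _ | k <;> first | rfl | simp at h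
  rw [mul_apply_of_form_eq_zero _ _ (fun j k h => hK j k (Or.inr h)),
    Finset.sum_eq_single Finset.univ]
  · rw [shuffleSign_univ, one_smul, Cochain.tensor]
    congr 1
    · have := η.apply_orderEmbOfFin (Finset.univ : Finset (Fin j)) (Finset.univ : Finset (Fin k))
        (Finset.card_fin j) (Finset.card_fin k) es αs
      rw [orderEmbOfFin_univ_eq_id, orderEmbOfFin_univ_eq_id] at this
      rw [← show η j k (es ∘ id) (αs ∘ id) = η j k es αs from rfl, ← this,
        η.apply_orderEmbOfFin _ Finset.univ rfl (Finset.card_fin k), orderEmbOfFin_univ_eq_id]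
      rfl
    · have := (Cochain.ofElem w : Cochain n F E W).apply_orderEmbOfFin
        (Finset.univ : Finset (Fin j))ᶜ (∅ : Finset (Fin 0)) (a := 0) (c := 0)
        (by simp) (by simp) es Fin.elim0
      exact this
  · intro S _ hS
    rw [hK _ _ (Or.inl (by simpa using hS))]
    simp
  · simp

/-- Multiplication with a cochain that is concentrated in the component with one section. -/
theorem Cochain.mul_apply_of_single (η : Cochain n F E (SmoothFun n M)) (K : Cochain n F E W)
    (hK : ∀ j k, j ≠ 1 ∨ k ≠ 0 → K j k = 0) (j k : ℕ) (es : Fin (j + 1) → Sec n F E)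
    (αs : Fin k → OneForm n M) :
    η.mul K (j + 1) k es αs = ∑ i : Fin (j + 1), (-1 : ℤ) ^ (j - i : ℕ) •
      (η j k (i.removeNth es) αs • K 1 0 (fun _ => es i) Fin.elim0) := by
  rw [mul_apply_of_form_eq_zero _ _ (fun j k h => hK j k (Or.inr h))]
  symm
  -- Only those S contribute whose complement has one element, the position handed to K.
  refine Finset.sum_of_injOn (fun i => ({i}ᶜ : Finset (Fin (j + 1)))) ?_ (by simp) ?_ ?_
  · intro i _ i' _ h
    simpa using h
  · intro S _ hS
    rw [hK, Pi.zero_apply, Pi.zero_apply, smul_zero, smul_zero]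
    refine Or.inl fun h => hS ?_
    obtain ⟨i, hi⟩ := Finset.card_eq_one.1 h
    exact ⟨i, by simp, by simp [← hi]⟩
  · intro i _
    rw [shuffleSign_compl_singleton]
    congr 2
    · have hc : ({i}ᶜ : Finset (Fin (j + 1))).card = j := by simp [Finset.card_compl]
      have := η.apply_orderEmbOfFin ({i}ᶜ : Finset (Fin (j + 1))) (Finset.univ : Finset (Fin k))
        hc (Finset.card_fin k) es αs
      rw [η.apply_orderEmbOfFin _ Finset.univ rfl (Finset.card_fin k),
        orderEmbOfFin_univ_eq_id] at this
      refine Eq.trans ?_ this.symm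
      rw [Finset.orderEmbOfFin_compl_singleton_eq_succAboveOrderEmb]
      rfl
    · have := K.apply_orderEmbOfFin ({i}ᶜ : Finset (Fin (j + 1)))ᶜ (∅ : Finset (Fin 0))
        (a := 1) (c := 0) (by simp) (by simp) es Fin.elim0
      refine Eq.trans ?_ this.symm
      congr 1
      · funext l
        have hl := Finset.orderEmbOfFin_mem ({i}ᶜ : Finset (Fin (j + 1)))ᶜ (k := 1) (by simp) l
        refine congrArg es (not_not.1 fun h => Finset.mem_compl.1 hl (Finset.mem_compl.2 ?_))
        exact fun h' => h (Finset.mem_singleton.1 h').symm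

end Mul

end Cochains

/-! ### Degrees, and passage between the two classes of cochains -/

section Cochains

variable {n : ℕ} {M : Type*} [TopologicalSpace M] [ChartedSpace (EuclideanSpace ℝ (Fin n)) M]
  [IsManifold (𝓡 n) ∞ M] [T2Space M]
  {F : Type*} [NormedAddCommGroup F] [NormedSpace ℝ F] [FiniteDimensional ℝ F]
  {E : M → Type*} [∀ x, AddCommGroup (E x)] [∀ x, Module ℝ (E x)] [∀ x, TopologicalSpace (E x)]
  [TopologicalSpace (TotalSpace F E)] [FiberBundle F E] [VectorBundle ℝ F E]
  [ContMDiffVectorBundle ∞ F E (𝓡 n)]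
  {W : Type*} [AddCommGroup W] [Module ℝ W] [Module (SmoothFun n M) W]

variable {𝒜 : CourantAlgebroid n M F E} {D : Sec n F E → W → W} {m : ℕ} {p : ℤ}
  {H : Cochain n F E W}

section Degree

omit [T2Space M] [Module ℝ W] [Module (SmoothFun n M) W]

theorem cochainDiff_degree (hD : ∀ e, D e 0 = 0)
    (h : ∀ j k : ℕ, (j : ℤ) + 2 * k ≠ p → H j k = 0) (j k : ℕ) (hjk : (j : ℤ) + 2 * k ≠ p + 1) :
    cochainDiff 𝒜 D H j k = 0 := by
  funext es αs
  have h1 : diffPartForm 𝒜 H j k es αs = 0 := by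
    cases k with
    | zero => rfl
    | succ k =>
      have h0 : H (j + 1) k = 0 := h _ _ fun h => hjk (by push_cast at h ⊢; linarith)
      simp [diffPartForm, h0]
  have h2 : diffPartDeriv 𝒜 D H j k es αs = 0 := by
    cases j with
    | zero => rfl
    | succ j =>
      have h0 : H j k = 0 := h _ _ fun h => hjk (by push_cast at h ⊢; linarith)
      simp [diffPartDeriv, h0, hD]
  have h3 : diffPartBracket 𝒜 H j k es αs = 0 := by
    cases j with
    | zero => rfl
    | succ j =>
      have h0 : H j k = 0 := h _ _ fun h => hjk (by push_cast at h ⊢; linarith)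
      simp [diffPartBracket, h0]
  simp [cochainDiff, h1, h2, h3]

omit [FiniteDimensional ℝ F] [ContMDiffVectorBundle ∞ F E (𝓡 n)] [∀ x, Module ℝ (E x)]
  [VectorBundle ℝ F E] in
theorem iSec_degree (h : ∀ j k : ℕ, (j : ℤ) + 2 * k ≠ p → H j k = 0) (e : Sec n F E) (j k : ℕ)
    (hjk : (j : ℤ) + 2 * k ≠ p - 1) : iSec e H j k = 0 := by
  funext es αs
  have h0 : H (j + 1) k = 0 := h _ _ fun h => hjk (by push_cast at h ⊢; linarith)
  simp [iSec, h0]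

end Degree

section

omit [FiniteDimensional ℝ F] [ContMDiffVectorBundle ∞ F E (𝓡 n)] [T2Space M]

variable {𝒜 : AnchoredMetricBundle n M F E}

/-- The stricter bound m - 1 in the last section is given up: the differential gets its bound m
there from the bounds (m, m) already. -/
theorem IsDiffCochain.isOrderCochain (h : IsDiffCochain 𝒜 p m H) : IsOrderCochain 𝒜 m m H where
  arg j k es αs i := by
    refine ⟨h.map_update_add j k es αs i, fun c e => h.map_update_smul j k es αs i c e, ?_⟩
    rw [ite_self]
    rcases (Nat.succ_le_of_lt i.isLt).lt_or_eq with hi | hi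
    · exact h.order_arg j k es αs i hi
    · exact (h.order_last j k es αs i hi).mono (by split_ifs <;> omega)
  form j k es αs i :=
    ⟨h.map_form_update_add j k es αs i, h.map_form_update_smul j k es αs i,
      h.order_form j k es αs i⟩
  symm := h.form_symm
  swap := h.add_swap

theorem IsOrderCochain.isDiffCochain (h : IsOrderCochain 𝒜 (m + 1) m H)
    (hdeg : ∀ j k : ℕ, (j : ℤ) + 2 * k ≠ p → H j k = 0) : IsDiffCochain 𝒜 p (m + 1) H where
  degree := hdeg
  map_update_add j k es αs i := (h.arg j k es αs i).map_add
  map_update_smul j k es αs i := (h.arg j k es αs i).map_smul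
  map_form_update_add j k es αs i := (h.form j k es αs i).map_add
  map_form_update_smul j k es αs i := (h.form j k es αs i).map_smul
  form_symm := h.symm
  add_swap := h.swap
  order_form j k es αs i := (h.form j k es αs i).isDiffOp
  order_arg j k es αs i hi := by
    have := (h.arg j k es αs i).isDiffOp
    rwa [if_neg hi.ne] at this
  order_last j k es αs i hi := by
    have := (h.arg j k es αs i).isDiffOp
    rw [if_pos hi] at this
    exact this.mono (by split_ifs <;> omega)

/-- A cochain of degree one only has a component with a single section. -/
theorem IsOrderCochain.isDiffCochain_one {a : ℕ} (h : IsOrderCochain 𝒜 a m H)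
    (hdeg : ∀ j k : ℕ, (j : ℤ) + 2 * k ≠ 1 → H j k = 0) : IsDiffCochain 𝒜 1 m H where
  degree := hdeg
  map_update_add j k es αs i := (h.arg j k es αs i).map_add
  map_update_smul j k es αs i := (h.arg j k es αs i).map_smul
  map_form_update_add j k es αs i := (h.form j k es αs i).map_add
  map_form_update_smul j k es αs i := (h.form j k es αs i).map_smul
  form_symm := h.symm
  add_swap := h.swap
  order_form j k es αs i := by
    rw [hdeg j k (by have := i.pos; omega)]
    exact .zero m
  order_arg j k es αs i hi := by
    rw [hdeg j k (by omega)]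
    exact .zero m
  order_last j k es αs i hi := by
    have := (h.arg j k es αs i).isDiffOp
    rwa [if_pos hi] at this

theorem isOrderCochain_ofElem (𝒜 : AnchoredMetricBundle n M F E) (a b : ℕ) (w : W) :
    IsOrderCochain 𝒜 a b (Cochain.ofElem w) where
  arg j k es αs i := by
    cases j with
    | zero => exact i.elim0
    | succ j => exact .zero _
  form j k es αs i := by
    cases k with
    | zero => exact i.elim0
    | succ k => cases j <;> exact .zero _
  symm j k es αs σ := by cases j <;> cases k <;> rfl
  swap j k es αs i := by
    have h1 : (Cochain.ofElem w : Cochain n F E W) (j + 2) k = 0 := rfl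
    have h2 : (Cochain.ofElem w : Cochain n F E W) j (k + 1) = 0 := by cases j <;> rfl
    simp [h1, h2]

omit [IsManifold (𝓡 n) ∞ M] in
theorem isLinDiffOp_smul_const
    {FB : Type*} [NormedAddCommGroup FB] [NormedSpace ℝ FB]
    {B : M → Type*} [∀ x, AddCommGroup (B x)] [∀ x, Module ℝ (B x)] [∀ x, TopologicalSpace (B x)]
    [TopologicalSpace (TotalSpace FB B)] [FiberBundle FB B] [VectorBundle ℝ FB B]
    (b : Sec n FB B) : IsLinDiffOp (SmoothFun n M) 0 (fun f : SmoothFun n M => f • b) :=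
  .of_linear (fun f g => add_smul f g b)
    (fun c f => by ext x : 1; exact mul_smul c (f x) (b x)) (fun f g => mul_smul f g b)

end

end Cochains

/-! ### Tensor products and the Dorfman covariant derivative -/

section Cochains

variable {n : ℕ} {M : Type*} [TopologicalSpace M] [ChartedSpace (EuclideanSpace ℝ (Fin n)) M]
  [IsManifold (𝓡 n) ∞ M] [T2Space M]
  {F : Type*} [NormedAddCommGroup F] [NormedSpace ℝ F] [FiniteDimensional ℝ F]
  {E : M → Type*} [∀ x, AddCommGroup (E x)] [∀ x, Module ℝ (E x)] [∀ x, TopologicalSpace (E x)]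
  [TopologicalSpace (TotalSpace F E)] [FiberBundle F E] [VectorBundle ℝ F E]
  [ContMDiffVectorBundle ∞ F E (𝓡 n)]

  {FB : Type*} [NormedAddCommGroup FB] [NormedSpace ℝ FB]
  {B : M → Type*} [∀ x, AddCommGroup (B x)] [∀ x, Module ℝ (B x)] [∀ x, TopologicalSpace (B x)]
  [TopologicalSpace (TotalSpace FB B)] [FiberBundle FB B] [VectorBundle ℝ FB B]
  {𝒜 : CourantAlgebroid n M F E} {P : Predual 𝒜 FB B} {p : ℤ} {m : ℕ}
  {η : Cochain n F E (SmoothFun n M)} {H : Cochain n F E (Sec n FB B)}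

omit [IsManifold (𝓡 n) ∞ M] [T2Space M] in
theorem IsDiffOp.smul_const {V : Type*} [AddCommGroup V] [Module (SmoothFun n M) V] {s : ℕ}
    {Q : V → SmoothFun n M} (hQ : IsDiffOp (SmoothFun n M) s Q) (b : Sec n FB B) :
    IsDiffOp (SmoothFun n M) s (fun v => Q v • b) := by
  have hb := isLinDiffOp_smul_const b
  simpa only [zero_add] using hb.isDiffOp.comp hb.map_add hQ

omit [FiniteDimensional ℝ F] [ContMDiffVectorBundle ∞ F E (𝓡 n)] [T2Space M] in
theorem IsDiffCochain.tensor {𝒜 : AnchoredMetricBundle n M F E} (h : IsDiffCochain 𝒜 p m η)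
    (b : Sec n FB B) : IsDiffCochain 𝒜 p m (η.tensor b) := by
  have hb := isLinDiffOp_smul_const b
  constructor
  · intro j k hjk
    funext es αs
    simp only [Cochain.tensor, h.degree j k hjk, Pi.zero_apply, zero_smul]
  · intro j k es αs i e e'
    simp only [Cochain.tensor, h.map_update_add, add_smul]
  · intro j k es αs i c e
    simp only [Cochain.tensor, h.map_update_smul]
    exact hb.map_smul c _
  · intro j k es αs i α α'
    simp only [Cochain.tensor, h.map_form_update_add, add_smul]
  · intro j k es αs i c α
    simp only [Cochain.tensor, h.map_form_update_smul]
    exact hb.map_smul c _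
  · intro j k es αs σ
    simp only [Cochain.tensor, h.form_symm]
  · intro j k es αs i
    simp only [Cochain.tensor]
    rw [← add_smul, h.add_swap, neg_smul]
  · exact fun j k es αs i => (h.order_form j k es αs i).smul_const b
  · exact fun j k es αs i hi => (h.order_arg j k es αs i hi).smul_const b
  · exact fun j k es αs i hi => (h.order_last j k es αs i hi).smul_const b

omit [T2Space M] in
theorem Predual.pair_smul_left (P : Predual 𝒜 FB B) (f : SmoothFun n M) (e : Sec n F E)
    (b : Sec n FB B) : P.pair (f • e) b = f * P.pair e b := by
  ext x
  exact DFunLike.congr_fun (map_smul (P.pairing x) (f x) (e x)) (b x)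

namespace DorfmanConnection

variable (C : DorfmanConnection P)

omit [T2Space M] in
theorem isSecAction : IsSecAction 𝒜.toAnchoredMetricBundle (fun e b => C.nabla e b) where
  left b := .of_symbol (fun f e => P.pair e b • P.dB f)
    (fun e e' => by rw [map_add, LinearMap.add_apply])
    (fun c e => by rw [map_smul, LinearMap.smul_apply]) (fun f e => C.nabla_smul_left f e b)
    (fun f g e => by rw [P.pair_smul_left, mul_smul])
  right e := .of_leibniz (fun f => 𝒜.deriv e f) (map_add _) (map_smul _) (C.nabla_smul_right e)
  leibniz := C.nabla_smul_right

omit [T2Space M] in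
theorem d_degree (h : ∀ j k : ℕ, (j : ℤ) + 2 * k ≠ p → H j k = 0) (j k : ℕ)
    (hjk : (j : ℤ) + 2 * k ≠ p + 1) : C.d H j k = 0 :=
  cochainDiff_degree (fun e => map_zero (C.nabla e)) h j k hjk

omit [T2Space M] in
theorem d_ofElem_degree (b : Sec n FB B) (j k : ℕ) (hjk : (j : ℤ) + 2 * k ≠ 1) :
    C.d (Cochain.ofElem b) j k = 0 := by
  refine C.d_degree (p := 0) (fun j k h => ?_) j k (by simpa using hjk)
  rcases j with _ | j <;> rcases k with _ | k <;> first | rfl | simp at h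

omit [T2Space M] in
theorem d_ofElem_apply (b : Sec n FB B) (es : Fin 1 → Sec n F E) (αs : Fin 0 → OneForm n M) :
    C.d (Cochain.ofElem b) 1 0 es αs = C.nabla (es 0) b := by
  simp [d, cochainDiff, diffPartForm, diffPartDeriv, diffPartBracket, Cochain.ofElem]

/-- The product of a cochain with `d^∇ b`, up to the sign `(-1)^p`. -/
def tensorNabla (η : Cochain n F E (SmoothFun n M)) (b : Sec n FB B) :
    Cochain n F E (Sec n FB B)
  | 0, _ => 0
  | j + 1, k => fun es αs =>
      ∑ i : Fin (j + 1), (-1 : ℤ) ^ (i : ℕ) • (η j k (i.removeNth es) αs • C.nabla (es i) b)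

omit [T2Space M] in
-- The ρ*-part and the bracket part are additive in the values and pass through η ⊗ b. Only the
-- derivative part produces more, through ∇_e(gb) = g∇_e b + ρ(e)(g)b.
theorem d_tensor (η : Cochain n F E (SmoothFun n M)) (b : Sec n FB B) :
    C.d (η.tensor b) = (𝒜.d η).tensor b + C.tensorNabla η b := by
  have h1 : diffPartForm 𝒜 (η.tensor b) = (diffPartForm 𝒜 η).tensor b := by
    funext j k es αs
    cases k with
    | zero => exact (zero_smul _ b).symm
    | succ k => exact (Finset.sum_smul (f := fun μ : Fin (k + 1) => η (j + 1) k _ _)).symm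
  have h2 : diffPartDeriv 𝒜 (fun e b => C.nabla e b) (η.tensor b) =
      (diffPartDeriv 𝒜 (fun e f => 𝒜.deriv e f) η).tensor b + C.tensorNabla η b := by
    funext j k es αs
    cases j with
    | zero => simp [diffPartDeriv, tensorNabla, Cochain.tensor]
    | succ j =>
      simp only [diffPartDeriv, tensorNabla, Cochain.tensor, Pi.add_apply, Finset.sum_smul]
      rw [← Finset.sum_add_distrib]
      refine Finset.sum_congr rfl fun i _ => ?_
      rw [smul_assoc, ← smul_add, sub_smul, Finset.sum_smul, C.nabla_smul_right]
      congr 1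
      abel
  have h3 : diffPartBracket 𝒜 (η.tensor b) = (diffPartBracket 𝒜 η).tensor b := by
    funext j k es αs
    cases j with
    | zero => exact (zero_smul _ b).symm
    | succ j =>
      simp only [diffPartBracket, Cochain.tensor, Finset.sum_smul, smul_assoc]
  funext j k es αs
  simp only [d, CourantAlgebroid.d, cochainDiff, h1, h2, h3, Pi.add_apply]
  simp only [Cochain.tensor, Pi.add_apply, add_smul]
  abel

omit [T2Space M] in
-- The cochain d^∇b takes exactly one section, so the shuffles are indexed by its position i, with
-- sign (-1)^(j - i). Homogeneity of η lets the global sign (-1)^p correct this to (-1)^i.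
theorem negOnePow_smul_mul_d_ofElem (h : ∀ j k : ℕ, (j : ℤ) + 2 * k ≠ p → η j k = 0)
    (b : Sec n FB B) : p.negOnePow • η.mul (C.d (Cochain.ofElem b)) = C.tensorNabla η b := by
  funext j k es αs
  change p.negOnePow • η.mul (C.d (Cochain.ofElem b)) j k es αs = _
  cases j with
  | zero =>
    rw [Cochain.mul_apply_of_form_eq_zero _ _ fun j k h => C.d_ofElem_degree b j k (by omega),
      Finset.sum_eq_zero, smul_zero]
    · rfl
    · intro S _
      have hS : Sᶜ.card = 0 := by rw [Finset.eq_empty_of_isEmpty Sᶜ, Finset.card_empty]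
      rw [C.d_ofElem_degree b _ _ (by rw [hS]; simp)]
      simp
  | succ j =>
    rw [Cochain.mul_apply_of_single _ _ fun j k h => C.d_ofElem_degree b j k (by omega),
      tensorNabla, Finset.smul_sum]
    refine Finset.sum_congr rfl fun i _ => ?_
    rw [C.d_ofElem_apply]
    by_cases hp : (j : ℤ) + 2 * k = p
    · have hsign : (p.negOnePow : ℤ) * (-1) ^ (j - i : ℕ) = (-1) ^ (i : ℕ) := by
        rw [← hp, Int.negOnePow_add, Int.negOnePow_two_mul, mul_one, Int.coe_negOnePow_natCast,
          ← pow_add, neg_one_pow_eq_pow_mod_two, neg_one_pow_eq_pow_mod_two (i : ℕ)]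
        congr 1
        have := i.isLt
        omega
      rw [Units.smul_def, smul_smul, hsign]
    · rw [h j k hp]
      simp

omit [T2Space M] in
-- The term i = 0 of the contracted sum is η ⊗ ∇_e b; the others, with shifted index and opposite
-- sign, cancel the second summand.
theorem iSec_tensorNabla (η : Cochain n F E (SmoothFun n M)) (b : Sec n FB B) (e : Sec n F E) :
    iSec e (C.tensorNabla η b) + C.tensorNabla (iSec e η) b = η.tensor (C.nabla e b) := by
  funext j k es αs
  simp only [Pi.add_apply, iSec, tensorNabla, Cochain.tensor]
  rw [Fin.sum_univ_succ]
  cases j with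
  | zero => simp
  | succ j =>
    simp only [Fin.cons_zero, Fin.cons_succ, removeNth_zero_cons,
      removeNth_succ_cons, Fin.val_zero, Fin.val_succ, pow_zero, one_smul, pow_succ, mul_neg,
      mul_one, neg_smul, Finset.sum_neg_distrib]
    abel

omit [T2Space M] in
theorem nablaOp_eq (e : Sec n F E) (H : Cochain n F E (Sec n FB B)) :
    C.nablaOp e H = iSec e (C.d H) + C.d (iSec e H) := by
  simp [nablaOp, gradedComm]

omit [T2Space M] in
theorem lieSec_eq (e : Sec n F E) (η : Cochain n F E (SmoothFun n M)) :
    𝒜.lieSec e η = iSec e (𝒜.d η) + 𝒜.d (iSec e η) := by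
  simp [CourantAlgebroid.lieSec, gradedComm]

/-- The degree -2 of i_f is even, so the graded commutator is the plain one, which
`iFun_cochainDiff` computes. No derivative of H remains, whence the formula for 𝓛^∇_f on η ⊗ b. -/
theorem lieFun_eq (f : SmoothFun n M) {H : Cochain n F E (Sec n FB B)}
    (h : ∀ j k es αs, H j (k + 1) es (Fin.cons 0 αs) = 0) :
    C.lieFun f H = iSec (𝒜.dE f) H := by
  have h1 := iFun_cochainDiff (𝒜 := 𝒜) (D := fun e b => C.nabla e b) h f
  have h2 : (-2 * 1 : ℤ).negOnePow = 1 := Int.negOnePow_even _ (by decide)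
  rw [lieFun, gradedComm, h2, one_smul, d, d, h1, add_sub_cancel_left]

omit [T2Space M] in
theorem nablaOp_ofElem (e : Sec n F E) (b : Sec n FB B) :
    C.nablaOp e (Cochain.ofElem b) = Cochain.ofElem (C.nabla e b) := by
  have h1 : iSec e (Cochain.ofElem b : Cochain n F E (Sec n FB B)) = 0 := rfl
  have h2 : C.d 0 = 0 := cochainDiff_zero fun e => map_zero (C.nabla e)
  rw [nablaOp_eq, h1, h2, add_zero]
  funext j k es αs
  by_cases hjk : j = 0 ∧ k = 0
  · obtain ⟨rfl, rfl⟩ := hjk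
    exact C.d_ofElem_apply b _ αs
  · have h3 : C.d (Cochain.ofElem b) (j + 1) k = 0 := C.d_ofElem_degree b _ _ (by omega)
    rw [iSec, h3]
    rcases j with _ | j <;> rcases k with _ | k <;> first | rfl | simp at hjk

omit [T2Space M] in
theorem nablaOp_tensor (e : Sec n F E) (η : Cochain n F E (SmoothFun n M)) (b : Sec n FB B) :
    C.nablaOp e (η.tensor b) = (𝒜.lieSec e η).tensor b + η.tensor (C.nabla e b) := by
  have h : iSec e (η.tensor b) = (iSec e η).tensor b := rfl
  rw [nablaOp_eq, h, d_tensor, d_tensor, lieSec_eq, ← C.iSec_tensorNabla]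
  funext j k es αs
  simp only [Pi.add_apply, iSec, Cochain.tensor, add_smul]
  abel

theorem isDiffCochain_d (hm : 1 ≤ m) (h : IsDiffCochain 𝒜.toAnchoredMetricBundle p m H) :
    IsDiffCochain 𝒜.toAnchoredMetricBundle (p + 1) (m + 1) (C.d H) :=
  (h.isOrderCochain.cochainDiff hm C.isSecAction).isDiffCochain (C.d_degree h.degree)

/-- Both i_e d^∇H and d^∇ i_e H satisfy the bounds (m + 1, m), since contraction preserves each pair
of bounds. Working with order bounds avoids treating degree 1 separately. -/
theorem isDiffCochain_nablaOp (hm : 1 ≤ m) (h : IsDiffCochain 𝒜.toAnchoredMetricBundle p m H)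
    (e : Sec n F E) :
    IsDiffCochain 𝒜.toAnchoredMetricBundle p (m + 1) (C.nablaOp e H) := by
  rw [nablaOp_eq]
  refine IsOrderCochain.isDiffCochain
    (((h.isOrderCochain.cochainDiff hm C.isSecAction).iSec e).add
      ((h.isOrderCochain.iSec e).cochainDiff hm C.isSecAction)) fun j k hjk => ?_
  have h1 := iSec_degree (C.d_degree h.degree) e j k (by simpa using hjk)
  have h2 := C.d_degree (iSec_degree h.degree e) j k (by simpa using hjk)
  change iSec e (C.d H) j k + C.d (iSec e H) j k = 0
  rw [h1, h2, add_zero]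

theorem isDiffCochain_lieFun (h : IsDiffCochain 𝒜.toAnchoredMetricBundle p m H)
    (f : SmoothFun n M) :
    IsDiffCochain 𝒜.toAnchoredMetricBundle (p - 1) (m + 1) (C.lieFun f H) := by
  rw [C.lieFun_eq f h.isOrderCochain.form_cons_zero]
  exact ((h.isOrderCochain.iSec _).mono (Nat.le_succ m) le_rfl).isDiffCochain
    (iSec_degree h.degree _)

theorem isDiffCochain_d_ofElem (b : Sec n FB B) :
    IsDiffCochain 𝒜.toAnchoredMetricBundle 1 1 (C.d (Cochain.ofElem b)) :=
  -- The differential gives the bounds (2, 1); in degree one the only section is the last, so the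
  -- bound 1 is the one that counts.
  ((isOrderCochain_ofElem 𝒜.toAnchoredMetricBundle 1 1 b).cochainDiff le_rfl
    C.isSecAction).isDiffCochain_one (C.d_ofElem_degree b)

end DorfmanConnection

end Cochains

end

/-! ### The proposition -/

theorem mainTheorem8 {n : ℕ} {M : Type*} [TopologicalSpace M] [T2Space M]
    [SecondCountableTopology M] [ChartedSpace (EuclideanSpace ℝ (Fin n)) M]
    [IsManifold (𝓡 n) ∞ M]
    {F : Type*} [NormedAddCommGroup F] [NormedSpace ℝ F] [FiniteDimensional ℝ F]
    {E : M → Type*} [∀ x, AddCommGroup (E x)] [∀ x, Module ℝ (E x)] [∀ x, TopologicalSpace (E x)]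
    [TopologicalSpace (TotalSpace F E)] [FiberBundle F E] [VectorBundle ℝ F E]
    [ContMDiffVectorBundle ∞ F E (𝓡 n)]
    {FB : Type*} [NormedAddCommGroup FB] [NormedSpace ℝ FB] [FiniteDimensional ℝ FB]
    {B : M → Type*} [∀ x, AddCommGroup (B x)] [∀ x, Module ℝ (B x)] [∀ x, TopologicalSpace (B x)]
    [TopologicalSpace (TotalSpace FB B)] [FiberBundle FB B] [VectorBundle ℝ FB B]
    [ContMDiffVectorBundle ∞ FB B (𝓡 n)]
    (𝒜 : CourantAlgebroid n M F E) (P : Predual 𝒜 FB B) (C : DorfmanConnection P) :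
    -- `d^∇` extends the Dorfman covariant derivation of sections and obeys the Leibniz rule
    ((∀ b : Sec n FB B, IsDiffCochain 𝒜.toAnchoredMetricBundle 1 1 (C.d (Cochain.ofElem b)) ∧
        ∀ es αs, C.d (Cochain.ofElem b) 1 0 es αs = C.nabla (es 0) b) ∧
      ∀ (p : ℤ) (m : ℕ), 1 ≤ m → ∀ η : Cochain n F E (SmoothFun n M),
        IsDiffCochain 𝒜.toAnchoredMetricBundle p m η → ∀ b : Sec n FB B,
          IsDiffCochain 𝒜.toAnchoredMetricBundle p m (η.tensor b) ∧
          C.d (η.tensor b) =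
            (𝒜.d η).tensor b + p.negOnePow • η.mul (C.d (Cochain.ofElem b))) ∧
    -- the operators `d^∇`, `∇_e`, `𝓛^∇_f` act on `𝔇(E; B)`, and `∇_e` extends the connection
    ((∀ (p : ℤ) (m : ℕ), 1 ≤ m → ∀ H : Cochain n F E (Sec n FB B),
        IsDiffCochain 𝒜.toAnchoredMetricBundle p m H →
          IsDiffCochain 𝒜.toAnchoredMetricBundle (p + 1) (m + 1) (C.d H) ∧
          (∀ e, IsDiffCochain 𝒜.toAnchoredMetricBundle p (m + 1) (C.nablaOp e H)) ∧
          ∀ f, IsDiffCochain 𝒜.toAnchoredMetricBundle (p - 1) (m + 1) (C.lieFun f H)) ∧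
      ∀ (e : Sec n F E) (b : Sec n FB B),
        C.nablaOp e (Cochain.ofElem b) = Cochain.ofElem (C.nabla e b)) ∧
    -- the identities
    ∀ (p : ℤ) (m : ℕ), 1 ≤ m → ∀ η : Cochain n F E (SmoothFun n M),
      IsDiffCochain 𝒜.toAnchoredMetricBundle p m η → ∀ b : Sec n FB B,
        (∀ e : Sec n F E, C.nablaOp e (η.tensor b) =
          (𝒜.lieSec e η).tensor b + η.mul (C.nablaOp e (Cochain.ofElem b))) ∧
        ∀ f : SmoothFun n M,
          C.lieFun f (η.tensor b) = (iSec (𝒜.dE f) η).tensor b := by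
  refine ⟨⟨fun b => ⟨C.isDiffCochain_d_ofElem b, C.d_ofElem_apply b⟩,
      fun p m _ η h b => ⟨h.tensor b, ?_⟩⟩,
    ⟨fun p m hm H h => ⟨C.isDiffCochain_d hm h, C.isDiffCochain_nablaOp hm h,
      C.isDiffCochain_lieFun h⟩, C.nablaOp_ofElem⟩,
    fun p m _ η h b => ⟨fun e => ?_, fun f => ?_⟩⟩
  · rw [C.negOnePow_smul_mul_d_ofElem h.degree, C.d_tensor]
  · rw [C.nablaOp_ofElem, Cochain.mul_ofElem, C.nablaOp_tensor]
  · exact C.lieFun_eq f (h.tensor b).isOrderCochain.form_cons_zero
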